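/- Let $n\ge 0$, let $\mathfrak S_n$ be the symmetric group with elementary transpositions $\sigma_i=(i\;i{+}1)$, $1\le i\le n-1$, and let $\mathbb C\mathfrak S_n$ be the complex vector space with basis $\mathfrak S_n$. Let $H\mathfrak S_n$ be the algebra of linear operators on $\mathbb C\mathfrak S_n$, acting on the right (so that $v\cdot fg=(v\cdot f)\cdot g$), generated by the operators $\sigma_i:\mu\mapsto\mu\sigma_i$ and $\pi_i$, $1\le i\le n-1$, where $\mu\cdot\pi_i=\mu$ if $\mu(i)>\mu(i+1)$ and $\mu\cdot\pi_i=\mu\sigma_i$ otherwise. Let $\bar\sigma_i$ be the operator $\mu\mapsto\sigma_i\mu$. Compositions of $n$ are identified with their descent sets, that is, with the subsets of $\{1,\dots,n-1\}$. For $I\subseteq\{1,\dots,n-1\}$ let $P_I:=\bigcap_{i\notin I}\ker(1+\bar\sigma_i)$, an $H\mathfrak S_n$-submodule of $\mathbb C\mathfrak S_n$; then $P_J\subseteq P_I$ whenever $J\subseteq I$. Let $\mathfrak S_I$ be the subgroup of $\mathfrak S_n$ generated by the $\sigma_i$ with $i\notin I$, and let $v_I:=\sum_{\nu\in\mathfrak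 S_I}\operatorname{sgn}(\nu)\,\nu$. For $\sigma\in\mathfrak S_n$ let $\operatorname{Rec}(\sigma):=\{i:\sigma^{-1}(i)>\sigma^{-1}(i+1)\}$ and $v_\sigma:=v_{\operatorname{Rec}(\sigma)}\,\sigma$. **Theorem.** The modules $S_I:=P_I\big/\sum_{J\subsetneq I}P_J$, for $I\subseteq\{1,\dots,n-1\}$, form a complete set of representatives of the simple right $H\mathfrak S_n$-modules: each $S_I$ is simple, $S_I\not\cong S_J$ for $I\ne J$, and every simple $H\mathfrak S_n$-module is isomorphic to some $S_I$. Moreover, for each $I$, the vectors $v_\sigma$ with $\operatorname{Rec}(\sigma)=I$ lie in $P_I$, and the family of their images in $S_I$ is a vector space basis of $S_I$. -/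

import Mathlib

namespace HeckeSym

/-- The first of the two positions `i`, `i + 1`. Throughout, everything is numbered from `0`: the set
`{1, …, n - 1}` is `Fin (n - 1)` and `{1, …, n}` is `Fin n`. Compositions of `n` are represented
by their descent sets, i.e. by arbitrary subsets `I : Finset (Fin (n - 1))`. -/
def lo {n : ℕ} (i : Fin (n - 1)) : Fin n := ⟨i.1, by omega⟩

/-- The second of the two positions `i`, `i + 1`. -/
def hi {n : ℕ} (i : Fin (n - 1)) : Fin n := ⟨i.1 + 1, by omega⟩

/-- The elementary transposition exchanging `i` and `i + 1`. -/
def s {n : ℕ} (i : Fin (n - 1)) : Equiv.Perm (Fin n) := Equiv.swap (lo i) (hi i)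

/-- Descent set of a permutation: the `i` with `μ i > μ (i + 1)`. -/
def Des {n : ℕ} (μ : Equiv.Perm (Fin n)) : Finset (Fin (n - 1)) :=
  Finset.univ.filter fun i => μ (hi i) < μ (lo i)

/-- Recoils of a permutation: the descents of its inverse. -/
def Rec {n : ℕ} (σ : Equiv.Perm (Fin n)) : Finset (Fin (n - 1)) := Des σ⁻¹

/-- The plain complex vector space with basis the permutations of `n` letters; a vector is given
by its family of coefficients. -/
def V (n : ℕ) : Type := Equiv.Perm (Fin n) → ℂ

noncomputable instance (n : ℕ) : AddCommGroup (V n) :=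
  inferInstanceAs (AddCommGroup (Equiv.Perm (Fin n) → ℂ))

noncomputable instance (n : ℕ) : Module ℂ (V n) :=
  inferInstanceAs (Module ℂ (Equiv.Perm (Fin n) → ℂ))

/-- The basis of `V n` consisting of the permutations. -/
noncomputable def e {n : ℕ} : Module.Basis (Equiv.Perm (Fin n)) ℂ (V n) :=
  Pi.basisFun ℂ (Equiv.Perm (Fin n))

/-- The linear operator on `V n` which sends each permutation `μ` to the permutation `f μ`. -/
noncomputable def op {n : ℕ} (f : Equiv.Perm (Fin n) → Equiv.Perm (Fin n)) :
    Module.End ℂ (V n) :=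
  e.constr ℂ fun μ => e (f μ)

theorem op_e {n : ℕ} (f : Equiv.Perm (Fin n) → Equiv.Perm (Fin n)) (μ : Equiv.Perm (Fin n)) :
    op f (e μ) = e (f μ) :=
  e.constr_basis ℂ (fun μ => e (f μ)) μ

/-- Elementary transposition acting on positions: `μ ↦ μ sᵢ`. -/
noncomputable def sigmaOp {n : ℕ} (i : Fin (n - 1)) : Module.End ℂ (V n) :=
  op fun μ => μ * s i

/-- Effect on one permutation of the elementary decreasing sort at positions `i`, `i + 1`. -/
def sortDec {n : ℕ} (i : Fin (n - 1)) (μ : Equiv.Perm (Fin n)) : Equiv.Perm (Fin n) :=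
  if μ (hi i) < μ (lo i) then μ else μ * s i

/-- Elementary decreasing sorting operator. -/
noncomputable def piOp {n : ℕ} (i : Fin (n - 1)) : Module.End ℂ (V n) :=
  op (sortDec i)

/-- Elementary transposition acting on values: `μ ↦ sᵢ μ`. -/
noncomputable def sigmaBar {n : ℕ} (i : Fin (n - 1)) : Module.End ℂ (V n) :=
  op fun μ => s i * μ

/-- The algebra of operators on `V n` generated by the elementary transpositions (acting on
positions) and the elementary sorting operators.  `Module.End` multiplies by `f * g = f ∘ g`; a right
module over the algebra of the same operators with the product `f g = g ∘ f` (operators written on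
the right) is the same thing as a left module over `HS n`. -/
noncomputable def subalgebraHS (n : ℕ) : Subalgebra ℂ (Module.End ℂ (V n)) :=
  Algebra.adjoin ℂ (Set.range sigmaOp ∪ Set.range piOp)

/-- The algebra `subalgebraHS n` as a type, with its usual structure and action on `V n`. -/
def HS (n : ℕ) : Type := subalgebraHS n

noncomputable instance (n : ℕ) : Ring (HS n) := inferInstanceAs (Ring (subalgebraHS n))

noncomputable instance (n : ℕ) : Algebra ℂ (HS n) :=
  inferInstanceAs (Algebra ℂ (subalgebraHS n))

noncomputable instance (n : ℕ) : Module (HS n) (V n) :=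
  inferInstanceAs (Module (subalgebraHS n) (V n))

instance (n : ℕ) : IsScalarTower ℂ (HS n) (V n) :=
  inferInstanceAs (IsScalarTower ℂ (subalgebraHS n) (V n))

/-- The action of `HS n` on `V n` is the evaluation of operators. -/
theorem smul_eq {n : ℕ} (f : HS n) (x : V n) : f • x = (f : subalgebraHS n).1 x := rfl

theorem sortDec_mul {n : ℕ} (i j : Fin (n - 1)) (μ : Equiv.Perm (Fin n)) :
    sortDec i (s j * μ) = sortDec i μ ∨ sortDec i (s j * μ) = s j * sortDec i μ := by
  by_cases h : (μ (lo i) = lo j ∧ μ (hi i) = hi j) ∨ (μ (lo i) = hi j ∧ μ (hi i) = lo j)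
  · left
    have hc : s j * μ = μ * s i := by
      have h1 : μ * s i = Equiv.swap (μ (lo i)) (μ (hi i)) * μ := by
        rw [s, Equiv.mul_swap_eq_swap_mul]
      rw [h1, s]
      rcases h with ⟨h, h'⟩ | ⟨h, h'⟩
      · rw [h, h']
      · rw [h, h', Equiv.swap_comm]
    have hl : lo j < hi j := by simp [lo, hi]
    have hss : s i * s i = 1 := Equiv.swap_mul_self _ _
    rw [hc]
    rcases h with ⟨h, h'⟩ | ⟨h, h'⟩ <;>
      simp [sortDec, s, h, h', hl, hl.le, mul_assoc]
  · right
    have key : (s j (μ (hi i)) < s j (μ (lo i))) ↔ μ (hi i) < μ (lo i) := by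
      have hne : μ (lo i) ≠ μ (hi i) := fun e => by
        have := μ.injective e
        simp [lo, hi] at this
      simp only [s, Equiv.swap_apply_def]
      generalize μ (lo i) = a at *
      generalize μ (hi i) = b at *
      simp only [lo, hi, Fin.ext_iff, Fin.lt_def] at *
      split_ifs <;> simp_all <;> omega
    simp only [sortDec, Equiv.Perm.mul_apply, key]
    split_ifs
    · rfl
    · rw [mul_assoc]

theorem ker_stable {n : ℕ} (j : Fin (n - 1)) (f : Module.End ℂ (V n)) (hf : f ∈ subalgebraHS n) :
    ∀ x ∈ LinearMap.ker (1 + sigmaBar j), f x ∈ LinearMap.ker (1 + sigmaBar j) := by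
  induction hf using Algebra.adjoin_induction with
  | mem f hf =>
    have key : (1 + sigmaBar j) ∘ₗ f ∘ₗ sigmaBar j = (1 + sigmaBar j) ∘ₗ f := by
      have hss : ∀ μ : Equiv.Perm (Fin n), s j * (s j * μ) = μ := fun μ => by
        rw [← mul_assoc, s, Equiv.swap_mul_self, one_mul]
      refine e.ext fun μ => ?_
      rcases hf with ⟨i, rfl⟩ | ⟨i, rfl⟩
      · simp [sigmaBar, sigmaOp, op_e, mul_assoc, hss, add_comm]
      · rcases sortDec_mul i j μ with h | h
        · simp [sigmaBar, piOp, op_e, h]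
        · simp [sigmaBar, piOp, op_e, h, hss, add_comm]
    intro x hx
    have hx' : sigmaBar j x = -x := by
      rw [LinearMap.mem_ker, LinearMap.add_apply, Module.End.one_apply] at hx
      exact eq_neg_of_add_eq_zero_right hx
    have h := LinearMap.congr_fun key x
    simp only [LinearMap.comp_apply, hx', map_neg] at h
    rw [LinearMap.mem_ker]
    have h2 : (2 : ℂ) • (1 + sigmaBar j) (f x) = 0 := by
      rw [two_smul]
      exact eq_neg_iff_add_eq_zero.mp h.symm
    exact (smul_eq_zero.mp h2).resolve_left two_ne_zero
  | algebraMap r =>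
    intro x hx
    simpa using Submodule.smul_mem _ r hx
  | add f g _ _ hf hg => exact fun x hx => Submodule.add_mem _ (hf x hx) (hg x hx)
  | mul f g _ _ hf hg => exact fun x hx => hf _ (hg x hx)

/-- The `HS n`-submodule `P_I = ⋂_{i ∉ I} ker (1 + σ̄ᵢ)` of the vectors which are left
`i`-antisymmetric for all `i ∉ I`. -/
noncomputable def P {n : ℕ} (I : Finset (Fin (n - 1))) : Submodule (HS n) (V n) where
  carrier := {x | ∀ i, i ∉ I → x ∈ LinearMap.ker (1 + sigmaBar i)}
  add_mem' hx hy i hi := Submodule.add_mem _ (hx i hi) (hy i hi)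
  zero_mem' _ _ := Submodule.zero_mem _
  smul_mem' f x hx i hi := ker_stable i f.1 f.2 x (hx i hi)

theorem P_mono {n : ℕ} {J I : Finset (Fin (n - 1))} (h : J ⊆ I) : P J ≤ P I :=
  fun _ hx i hi => hx i fun hJ => hi (h hJ)

/-- The sum of the `P_J` over all proper subsets `J` of `I`, as a submodule of `P_I`. (All these `P_J`
are contained in `P_I`, by `P_mono`.) -/
noncomputable def sumBelow {n : ℕ} (I : Finset (Fin (n - 1))) : Submodule (HS n) (P I) :=
  (⨆ J : Finset (Fin (n - 1)), ⨆ _ : J ⊂ I, P J).submoduleOf (P I)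

/-- `S_I = P_I / ∑_{J ⊊ I} P_J`. -/
abbrev S {n : ℕ} (I : Finset (Fin (n - 1))) : Type := P I ⧸ sumBelow I

/-- The canonical projection of `P_I` onto `S_I`. -/
noncomputable def proj {n : ℕ} (I : Finset (Fin (n - 1))) : P I →ₗ[HS n] S I := (sumBelow I).mkQ

/-- The standard Young subgroup generated by the elementary transpositions `sᵢ` with `i ∉ I`. -/
def young {n : ℕ} (I : Finset (Fin (n - 1))) : Subgroup (Equiv.Perm (Fin n)) :=
  Subgroup.closure {t | ∃ i, i ∉ I ∧ t = s i}

open Classical in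
/-- `v_I`, the signed sum of the elements of the Young subgroup of `I`; the sign of `ν` is
`(-1) ^ ℓ(ν)`. -/
noncomputable def vSet {n : ℕ} (I : Finset (Fin (n - 1))) : V n :=
  ∑ ν ∈ Finset.univ.filter (fun ν => ν ∈ young I),
    (((Equiv.Perm.sign ν : ℤˣ) : ℤ) : ℂ) • e ν

/-- `v_σ = v_{Rec σ} · σ` (multiplication on the right by `σ`). -/
noncomputable def vPerm {n : ℕ} (σ : Equiv.Perm (Fin n)) : V n :=
  op (fun ν => ν * σ) (vSet (Rec σ))

end HeckeSym

namespace HeckeSym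

/-! Cut the values into blocks at the elements of `I`; left multiplication by `young I` permutes
values inside blocks. A `σ` with `Rec σ ⊆ I` lists each block in increasing order, so it has the
fewest inversions in its coset `young I · σ`. Hence `v_σ` is `σ` plus terms with strictly more
inversions, and the `v_σ` form a basis of `V n`. Antisymmetrization shows that `P I` is spanned by
the translates `v_I · σ` with `Rec σ ⊆ I`; comparing dimensions, it has basis the `v_σ` with `Rec σ
⊆ I`. This one basis is adapted to all the `P I`, which gives the basis of `S I` (`mem_P_iff`,
`mem_sumBelow_iff`).

A sort kills `v_I · σ` or moves it to another such translate (`piOp_vShift`). Choose sorts `L`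
carrying `v_I` to `v_I · w`, where the blocks of `w` decrease along positions (`exists_sort`).
Sorting is monotone for the Bruhat order, in which the identity is least, so whatever `L` does not
kill ends with the blocks of `w`. It follows that `L` kills `v_I · μ` unless `μ ∈ young I · young
Iᶜ`.

Simplicity: in a combination of the `v_σ` with `Rec σ = I`, let `σ₀` have the fewest inversions
among the terms present. Translating by `σ₀⁻¹` and then applying `L` leaves only the `σ₀` term, a
nonzero multiple of `v_I · w`, which generates `P I`. Non-isomorphism: `L` acts nontrivially on `S
I`, but kills `P J` unless `I ⊆ J`. Completeness: `HS n` embeds in a power of `V n = P univ`, and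
the modules `P J` reduce inductively to the `S J`. -/

theorem lo_lt_hi {n : ℕ} (i : Fin (n - 1)) : lo i < hi i := by simp [lo, hi, Fin.lt_def]

theorem s_mul_s {n : ℕ} (i : Fin (n - 1)) : s i * s i = 1 := Equiv.swap_mul_self _ _

theorem s_mul_s_mul {n : ℕ} (i : Fin (n - 1)) (μ : Equiv.Perm (Fin n)) : s i * (s i * μ) = μ := by
  rw [← mul_assoc, s_mul_s, one_mul]

theorem s_lo {n : ℕ} (i : Fin (n - 1)) : s i (lo i) = hi i := Equiv.swap_apply_left _ _

theorem s_hi {n : ℕ} (i : Fin (n - 1)) : s i (hi i) = lo i := Equiv.swap_apply_right _ _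

theorem sign_s {n : ℕ} (i : Fin (n - 1)) : Equiv.Perm.sign (s i) = -1 :=
  Equiv.Perm.sign_swap (lo_lt_hi i).ne

theorem mem_Des {n : ℕ} {μ : Equiv.Perm (Fin n)} {i : Fin (n - 1)} :
    i ∈ Des μ ↔ μ (hi i) < μ (lo i) := by simp [Des]

theorem mem_Rec {n : ℕ} {μ : Equiv.Perm (Fin n)} {i : Fin (n - 1)} :
    i ∈ Rec μ ↔ μ⁻¹ (hi i) < μ⁻¹ (lo i) := by simp [Rec, mem_Des]

theorem not_mem_Rec {n : ℕ} {μ : Equiv.Perm (Fin n)} {i : Fin (n - 1)} :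
    i ∉ Rec μ ↔ μ⁻¹ (lo i) < μ⁻¹ (hi i) := by
  rw [mem_Rec, not_lt, le_iff_lt_or_eq]
  exact or_iff_left fun h => (lo_lt_hi i).ne (μ⁻¹.injective h)

theorem mem_Rec_s_mul {n : ℕ} {μ : Equiv.Perm (Fin n)} {i : Fin (n - 1)} :
    i ∈ Rec (s i * μ) ↔ i ∉ Rec μ := by
  have h : (s i)⁻¹ = s i := Equiv.swap_inv _ _
  rw [mem_Rec, not_mem_Rec, mul_inv_rev, h, Equiv.Perm.mul_apply, Equiv.Perm.mul_apply, s_lo, s_hi]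

/-! ### Blocks of values, inversions and Young cosets -/

/-- The index of the block of a value with respect to the composition of descent set `I`. -/
def blk {n : ℕ} (I : Finset (Fin (n - 1))) (a : Fin n) : ℕ := (I.filter fun i => i.1 < a.1).card

theorem blk_mono {n : ℕ} (I : Finset (Fin (n - 1))) : Monotone (blk I) := fun a b h =>
  Finset.card_le_card fun i hi => by
    simp only [Finset.mem_filter, Fin.le_def] at *
    exact ⟨hi.1, hi.2.trans_le h⟩

theorem blk_eq {n : ℕ} {I : Finset (Fin (n - 1))} {i : Fin (n - 1)} (h : i ∉ I) :
    blk I (lo i) = blk I (hi i) := by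
  unfold blk
  congr 1
  refine Finset.filter_congr fun j hj => ?_
  have : j.1 ≠ i.1 := fun e => h (Fin.ext e ▸ hj)
  simp only [lo, hi]
  omega

theorem blk_lt {n : ℕ} {I : Finset (Fin (n - 1))} {i : Fin (n - 1)} (h : i ∈ I) :
    blk I (lo i) < blk I (hi i) := by
  refine Finset.card_lt_card ((Finset.ssubset_iff_of_subset fun j hj => ?_).2 ⟨i, ?_, ?_⟩)
  · rw [Finset.mem_filter] at hj ⊢
    exact ⟨hj.1, hj.2.trans (Nat.lt_succ_self _)⟩
  · simp [hi, h]
  · simp [lo]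

/-- A transitive relation between neighbours in a common block holds throughout the block. -/
theorem rel_of_adjacent {n : ℕ} (I : Finset (Fin (n - 1))) (r : Fin n → Fin n → Prop)
    (ht : ∀ a b c, r a b → r b c → r a c) (h : ∀ i, i ∉ I → r (lo i) (hi i)) {a b : Fin n}
    (hab : a < b) (hblk : blk I a = blk I b) : r a b := by
  obtain ⟨k, hk⟩ : ∃ k, b.1 = a.1 + k + 1 := ⟨b.1 - a.1 - 1, by have := Fin.lt_def.1 hab; omega⟩
  induction k generalizing b with
  | zero =>
    have hb := b.2
    let i : Fin (n - 1) := ⟨a.1, by omega⟩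
    have ha : a = lo i := rfl
    have hb : b = hi i := Fin.ext hk
    rw [ha, hb] at hblk ⊢
    exact h i fun hi => (blk_lt hi).ne hblk
  | succ k ih =>
    have hb := b.2
    let i : Fin (n - 1) := ⟨a.1 + k + 1, by omega⟩
    have hb : b = hi i := Fin.ext hk
    have h1 : a ≤ lo i := by simp only [Fin.le_def, lo, i]; omega
    have e1 : blk I a = blk I (lo i) := le_antisymm (blk_mono I h1)
      (hblk ▸ hb ▸ blk_mono I (lo_lt_hi i).le)
    refine ht _ _ _ (ih (b := lo i) (by simp only [Fin.lt_def, lo, i]; omega) e1 rfl) ?_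
    rw [hb] at hblk ⊢
    exact h i fun hi => (blk_lt hi).ne (e1.symm.trans hblk)

theorem blk_empty {n : ℕ} (a : Fin n) : blk ∅ a = 0 := by simp [blk]

theorem blk_young {n : ℕ} {I : Finset (Fin (n - 1))} {ν : Equiv.Perm (Fin n)} (h : ν ∈ young I)
    (a : Fin n) : blk I (ν a) = blk I a := by
  induction h using Subgroup.closure_induction generalizing a with
  | mem t ht =>
    obtain ⟨i, hi, rfl⟩ := ht
    rw [s, Equiv.swap_apply_def]
    split_ifs with h1 h2
    · rw [h1, blk_eq hi]
    · rw [h2, blk_eq hi]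
    · rfl
  | one => rfl
  | mul x y _ _ hx hy => rw [Equiv.Perm.mul_apply, hx, hy]
  | inv x _ hx => rw [← hx, Equiv.Perm.inv_def, Equiv.apply_symm_apply]

theorem s_mem_young {n : ℕ} {I : Finset (Fin (n - 1))} {i : Fin (n - 1)} (h : i ∉ I) :
    s i ∈ young I := Subgroup.subset_closure ⟨i, h, rfl⟩

/-- The inversions of a permutation, as pairs of positions. -/
def inv {n : ℕ} (μ : Equiv.Perm (Fin n)) : Finset (Fin n × Fin n) :=
  Finset.univ.filter fun p => p.1 < p.2 ∧ μ p.2 < μ p.1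

theorem mem_inv {n : ℕ} {μ : Equiv.Perm (Fin n)} {p q : Fin n} :
    (p, q) ∈ inv μ ↔ p < q ∧ μ q < μ p := by simp [inv]

/-- The inversions determine all comparisons of values, and a value is the number of smaller ones.
-/
theorem inv_injective {n : ℕ} : Function.Injective (inv (n := n)) := by
  intro μ ν h
  have key : ∀ p q, μ q < μ p ↔ ν q < ν p := by
    intro p q
    rcases lt_trichotomy p q with hpq | rfl | hpq
    · have := Finset.ext_iff.1 h (p, q)
      simpa [mem_inv, hpq] using this
    · simp
    · have := Finset.ext_iff.1 h (q, p)
      simp only [mem_inv, hpq, true_and] at this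
      have h1 : μ q ≠ μ p := fun e => hpq.ne (μ.injective e)
      have h2 : ν q ≠ ν p := fun e => hpq.ne (ν.injective e)
      rw [← h1.le_iff_lt, ← h2.le_iff_lt, ← not_lt, ← not_lt, this]
  have rank : ∀ (μ : Equiv.Perm (Fin n)) p,
      (Finset.univ.filter fun q => μ q < μ p).card = (μ p).1 := fun μ p => by
    rw [← Finset.card_map μ.toEmbedding, ← Fin.card_Iio (μ p)]
    congr 1
    ext a
    simp only [Finset.mem_map, Finset.mem_filter, Finset.mem_univ, true_and, Finset.mem_Iio]
    exact ⟨by rintro ⟨q, hq, rfl⟩; exact hq, fun ha => ⟨μ⁻¹ a, by simpa using ha, by simp⟩⟩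
  ext p
  rw [← rank, ← rank]
  simp only [key]

/-- `Rec σ ⊆ I` says that `σ⁻¹` increases across each step outside `I`, hence along each block of
values. -/
theorem lt_of_inv {n : ℕ} {I : Finset (Fin (n - 1))} {σ : Equiv.Perm (Fin n)} (h : Rec σ ⊆ I)
    {p q : Fin n} (hpq : p < q) (hblk : blk I (σ p) = blk I (σ q)) : σ p < σ q := by
  by_contra hc
  have hlt : σ q < σ p := lt_of_le_of_ne (not_lt.1 hc) fun e => hpq.ne' (σ.injective e)
  have := rel_of_adjacent I (fun a b => σ⁻¹ a < σ⁻¹ b) (fun _ _ _ => lt_trans)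
    (fun i hi => not_mem_Rec.1 fun hr => hi (h hr)) hlt hblk.symm
  simp only [Equiv.Perm.inv_def, Equiv.symm_apply_apply] at this
  exact this.not_gt hpq

theorem gt_of_inv {n : ℕ} {I : Finset (Fin (n - 1))} {σ : Equiv.Perm (Fin n)}
    (h : ∀ i, i ∉ I → i ∈ Rec σ) {p q : Fin n} (hpq : p < q)
    (hblk : blk I (σ p) = blk I (σ q)) : σ q < σ p := by
  by_contra hc
  have hlt : σ p < σ q := lt_of_le_of_ne (not_lt.1 hc) fun e => hpq.ne (σ.injective e)
  have := rel_of_adjacent I (fun a b => σ⁻¹ b < σ⁻¹ a) (fun _ _ _ h1 h2 => lt_trans h2 h1)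
    (fun i hi => mem_Rec.1 (h i hi)) hlt hblk
  simp only [Equiv.Perm.inv_def, Equiv.symm_apply_apply] at this
  exact this.not_gt hpq

theorem mem_inv_iff_blk {n : ℕ} {I : Finset (Fin (n - 1))} {σ : Equiv.Perm (Fin n)}
    (h : Rec σ ⊆ I) {p q : Fin n} :
    (p, q) ∈ inv σ ↔ p < q ∧ blk I (σ q) < blk I (σ p) := by
  rw [mem_inv]
  refine and_congr_right fun hpq => ⟨fun hlt => ?_, fun hb => (blk_mono I).reflect_lt hb⟩
  exact lt_of_le_of_ne (blk_mono I hlt.le) fun e => (lt_of_inv h hpq e.symm).not_gt hlt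

/-- All inversions of `σ` are between different blocks, and `ν` preserves blocks: `σ` is minimal in
its coset. -/
theorem inv_subset_inv_mul {n : ℕ} {I : Finset (Fin (n - 1))} {σ ν : Equiv.Perm (Fin n)}
    (h : Rec σ ⊆ I) (hν : ν ∈ young I) : inv σ ⊆ inv (ν * σ) := by
  rintro ⟨p, q⟩ hpq
  rw [mem_inv_iff_blk h] at hpq
  rw [mem_inv]
  refine ⟨hpq.1, (blk_mono I).reflect_lt ?_⟩
  simpa [blk_young hν] using hpq.2

/-- Dually, `σ` reverses every block, so it is maximal in its coset. -/
theorem inv_mul_subset_inv {n : ℕ} {I : Finset (Fin (n - 1))} {σ ν : Equiv.Perm (Fin n)}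
    (h : ∀ i, i ∉ I → i ∈ Rec σ) (hν : ν ∈ young I) : inv (ν * σ) ⊆ inv σ := by
  rintro ⟨p, q⟩ hpq
  rw [mem_inv] at hpq ⊢
  refine ⟨hpq.1, ?_⟩
  have hle := blk_mono I hpq.2.le
  simp only [Equiv.Perm.mul_apply, blk_young hν] at hle
  rcases hle.eq_or_lt with he | hlt
  · exact gt_of_inv h hpq.1 he.symm
  · exact (blk_mono I).reflect_lt hlt

theorem inv_ssubset_inv_s_mul {n : ℕ} {σ : Equiv.Perm (Fin n)} {i : Fin (n - 1)} (h : i ∉ Rec σ) :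
    inv σ ⊂ inv (s i * σ) := by
  refine (inv_subset_inv_mul (I := Rec σ) subset_rfl (s_mem_young h)).ssubset_of_ne fun e => ?_
  have := inv_injective e
  have h2 := mem_Rec_s_mul (μ := σ) (i := i)
  rw [← this] at h2
  tauto

theorem eq_one_of_Rec {n : ℕ} {σ : Equiv.Perm (Fin n)} (h : Rec σ = ∅) : σ = 1 := by
  refine inv_injective ((Finset.eq_empty_of_forall_notMem ?_).trans
    (Finset.eq_empty_of_forall_notMem ?_).symm)
  · rintro ⟨p, q⟩ hpq
    simp [mem_inv_iff_blk h.subset, blk_empty] at hpq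
  · rintro ⟨p, q⟩ hpq
    rw [mem_inv] at hpq
    exact hpq.1.not_gt hpq.2

/-- Every permutation is obtained from the identity by exchanging neighbouring values, creating
an inversion each time. -/
theorem perm_induction {n : ℕ} {motive : Equiv.Perm (Fin n) → Prop} (one : motive 1)
    (step : ∀ i μ, i ∉ Rec μ → motive μ → motive (s i * μ)) (μ : Equiv.Perm (Fin n)) :
    motive μ := by
  induction hk : (inv μ).card using Nat.strong_induction_on generalizing μ with
  | _ k ih =>
    by_cases hr : Rec μ = ∅
    · rw [eq_one_of_Rec hr]; exact one
    · obtain ⟨i, hi⟩ := Finset.nonempty_iff_ne_empty.2 hr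
      have h1 : i ∉ Rec (s i * μ) := fun h => mem_Rec_s_mul.1 h hi
      have h2 := step i (s i * μ) h1
      have h3 := Finset.card_lt_card (inv_ssubset_inv_s_mul h1)
      rw [s_mul_s_mul] at h2 h3
      exact h2 (ih _ (hk ▸ h3) _ rfl)

/-- Every permutation is in the same coset of `young I` as one without recoils outside `I`. -/
theorem exists_young_mul {n : ℕ} (I : Finset (Fin (n - 1))) (μ : Equiv.Perm (Fin n)) :
    ∃ ν ∈ young I, ∃ σ, Rec σ ⊆ I ∧ μ = ν * σ := by
  induction hk : (inv μ).card using Nat.strong_induction_on generalizing μ with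
  | _ k ih =>
    by_cases hr : Rec μ ⊆ I
    · exact ⟨1, one_mem _, μ, hr, (one_mul μ).symm⟩
    · obtain ⟨i, hi, hI⟩ := Finset.not_subset.1 hr
      have h1 : i ∉ Rec (s i * μ) := fun h => mem_Rec_s_mul.1 h hi
      have h3 := Finset.card_lt_card (inv_ssubset_inv_s_mul h1)
      rw [s_mul_s_mul] at h3
      obtain ⟨ν, hν, σ, hσ, e⟩ := ih _ (hk ▸ h3) _ rfl
      exact ⟨s i * ν, mul_mem (s_mem_young hI) hν, σ, hσ, by rw [mul_assoc, ← e, s_mul_s_mul]⟩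

/-! ### The sorting operators and the Bruhat order -/

/-- Number of the first `k` positions at which the values of `μ` satisfy `Q`. -/
def rk {n : ℕ} (Q : Fin n → Prop) [DecidablePred Q] (μ : Equiv.Perm (Fin n)) (k : ℕ) : ℕ :=
  (Finset.univ.filter fun p : Fin n => p.1 < k ∧ Q (μ p)).card

theorem rk_succ {n : ℕ} (Q : Fin n → Prop) [DecidablePred Q] (μ : Equiv.Perm (Fin n)) (p : Fin n) :
    rk Q μ (p.1 + 1) = rk Q μ p.1 + if Q (μ p) then 1 else 0 := by
  unfold rk
  split_ifs with h
  · rw [← Finset.card_insert_of_notMem (a := p) (by simp)]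
    congr 1
    ext q
    simp only [Finset.mem_filter, Finset.mem_univ, true_and, Finset.mem_insert]
    constructor
    · rintro ⟨h1, h2⟩
      rcases Nat.lt_succ_iff_lt_or_eq.1 h1 with h1 | h1
      · exact Or.inr ⟨h1, h2⟩
      · exact Or.inl (Fin.ext h1)
    · rintro (rfl | ⟨h1, h2⟩)
      · exact ⟨by omega, h⟩
      · exact ⟨by omega, h2⟩
  · rw [add_zero]
    congr 1
    ext q
    simp only [Finset.mem_filter, Finset.mem_univ, true_and]
    refine ⟨fun ⟨h1, h2⟩ => ⟨?_, h2⟩, fun ⟨h1, h2⟩ => ⟨by omega, h2⟩⟩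
    rcases Nat.lt_succ_iff_lt_or_eq.1 h1 with h1 | h1
    · exact h1
    · exact absurd (Fin.ext h1 ▸ h2) h

/-- Only the prefix of length `i + 1` separates the two exchanged positions. -/
theorem s_apply_lt_iff {n : ℕ} {i : Fin (n - 1)} {k : ℕ} (hk : k ≠ i.1 + 1) (p : Fin n) :
    (s i p).1 < k ↔ p.1 < k := by
  rw [s, Equiv.swap_apply_def]
  split_ifs with h1 h2
  · rw [h1]; simp only [lo, hi]; omega
  · rw [h2]; simp only [lo, hi]; omega
  · rfl

theorem rk_mul_s {n : ℕ} (Q : Fin n → Prop) [DecidablePred Q] (μ : Equiv.Perm (Fin n))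
    (i : Fin (n - 1)) {k : ℕ} (hk : k ≠ i.1 + 1) : rk Q (μ * s i) k = rk Q μ k := by
  unfold rk
  refine Finset.card_bijective (s i) (s i).bijective fun p => ?_
  rw [Finset.mem_filter_univ, Finset.mem_filter_univ, s_apply_lt_iff hk, Equiv.Perm.mul_apply]

theorem rk_sortDec_of_ne {n : ℕ} (Q : Fin n → Prop) [DecidablePred Q] (μ : Equiv.Perm (Fin n))
    (i : Fin (n - 1)) {k : ℕ} (hk : k ≠ i.1 + 1) : rk Q (sortDec i μ) k = rk Q μ k := by
  unfold sortDec
  split_ifs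
  · rfl
  · exact rk_mul_s Q μ i hk

/-- After the sort, the larger of the two values comes first, so the first position satisfies `Q` as
soon as either did. The right side is monotone in the ranks of `μ`, hence sorting respects the
Bruhat order. -/
theorem rk_sortDec {n : ℕ} {Q : Fin n → Prop} [DecidablePred Q] (hQ : Monotone Q)
    (μ : Equiv.Perm (Fin n)) (i : Fin (n - 1)) :
    rk Q (sortDec i μ) (i.1 + 1) = min (rk Q μ i.1 + 1) (rk Q μ (i.1 + 2)) := by
  have h1 := rk_succ Q (sortDec i μ) (lo i)
  have h2 := rk_succ Q μ (lo i)
  have h3 := rk_succ Q μ (hi i)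
  have h4 := rk_sortDec_of_ne Q μ i (k := (lo i).1) (by simp [lo])
  have h4 : rk Q (sortDec i μ) i.1 = rk Q μ i.1 := h4
  rw [show (lo i).1 = i.1 from rfl] at h1 h2
  rw [show (hi i).1 = i.1 + 1 from rfl] at h3
  rw [h1, h3, h2, h4]
  have h5 : Q (sortDec i μ (lo i)) ↔ Q (μ (lo i)) ∨ Q (μ (hi i)) := by
    unfold sortDec
    split_ifs with hlt
    · exact ⟨Or.inl, fun h => h.elim id fun h => hQ hlt.le h⟩
    · rw [Equiv.Perm.mul_apply, s_lo]
      exact ⟨Or.inr, fun h => h.elim (fun h => hQ (not_lt.1 hlt) h) id⟩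
  simp only [h5]
  by_cases h6 : Q (μ (lo i)) <;> by_cases h7 : Q (μ (hi i)) <;> simp [h6, h7]

theorem rk_le_rk_sortDec {n : ℕ} {Q : Fin n → Prop} [DecidablePred Q] (hQ : Monotone Q)
    {μ ν : Equiv.Perm (Fin n)} (h : ∀ k, rk Q μ k ≤ rk Q ν k) (i : Fin (n - 1)) (k : ℕ) :
    rk Q (sortDec i μ) k ≤ rk Q (sortDec i ν) k := by
  by_cases hk : k = i.1 + 1
  · rw [hk, rk_sortDec hQ, rk_sortDec hQ]
    exact min_le_min (Nat.succ_le_succ (h _)) (h _)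
  · rw [rk_sortDec_of_ne Q μ i hk, rk_sortDec_of_ne Q ν i hk]
    exact h k

/-- The identity lists small values first: if its prefix meets `Q`, it already contains all values
outside `Q`. -/
theorem rk_one_le {n : ℕ} {Q : Fin n → Prop} [DecidablePred Q] (hQ : Monotone Q)
    (μ : Equiv.Perm (Fin n)) (k : ℕ) : rk Q 1 k ≤ rk Q μ k := by
  have hc : ∀ μ : Equiv.Perm (Fin n), rk Q μ k + rk (fun a => ¬ Q a) μ k =
      (Finset.univ.filter fun p : Fin n => p.1 < k).card := fun μ => by
    unfold rk
    rw [← Finset.filter_filter, ← Finset.filter_filter, Finset.card_filter_add_card_filter_not]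
  have h1 := hc 1
  have h2 := hc μ
  by_cases hq : ∃ p : Fin n, p.1 < k ∧ Q p
  · obtain ⟨p, hp, hQp⟩ := hq
    have : rk (fun a => ¬ Q a) μ k ≤ rk (fun a => ¬ Q a) 1 k := by
      refine Finset.card_le_card_of_injOn μ ?_ μ.injective.injOn
      intro q hq
      rw [Finset.mem_coe, Finset.mem_filter_univ] at hq ⊢
      exact ⟨lt_trans (Fin.lt_def.1 (not_le.1 fun hle => hq.2 (hQ hle hQp))) hp, hq.2⟩
    omega
  · have : rk Q 1 k = 0 := by
      refine Finset.card_eq_zero.2 (Finset.eq_empty_of_forall_notMem fun p hp => hq ⟨p, ?_⟩)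
      rwa [Finset.mem_filter_univ] at hp
    omega

/-- Sorting successively at the positions of a list. -/
def sortL {n : ℕ} (L : List (Fin (n - 1))) (μ : Equiv.Perm (Fin n)) : Equiv.Perm (Fin n) :=
  L.foldl (fun μ i => sortDec i μ) μ

theorem sortL_cons {n : ℕ} (i : Fin (n - 1)) (L : List (Fin (n - 1))) (μ : Equiv.Perm (Fin n)) :
    sortL (i :: L) μ = sortL L (sortDec i μ) := rfl

theorem sortL_append {n : ℕ} (L : List (Fin (n - 1))) (i : Fin (n - 1))
    (μ : Equiv.Perm (Fin n)) : sortL (L ++ [i]) μ = sortDec i (sortL L μ) := by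
  simp [sortL]

theorem rk_le_rk_sortL {n : ℕ} {Q : Fin n → Prop} [DecidablePred Q] (hQ : Monotone Q)
    (L : List (Fin (n - 1))) {μ ν : Equiv.Perm (Fin n)} (h : ∀ k, rk Q μ k ≤ rk Q ν k) (k : ℕ) :
    rk Q (sortL L μ) k ≤ rk Q (sortL L ν) k := by
  induction L generalizing μ ν with
  | nil => exact h k
  | cons i L ih => exact ih (rk_le_rk_sortDec hQ h i)

/-- If the blocks of the values of `w` decrease, then so do those of `y` as soon as `y` dominates
`w` in the Bruhat order. -/
theorem blk_eq_of_rk_le {n : ℕ} {I : Finset (Fin (n - 1))} {w y : Equiv.Perm (Fin n)}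
    (hw : Antitone fun p => blk I (w p))
    (h : ∀ b k, rk (fun a => b ≤ blk I a) w k ≤ rk (fun a => b ≤ blk I a) y k) (p : Fin n) :
    blk I (y p) = blk I (w p) := by
  have key : ∀ b p, b ≤ blk I (y p) ↔ b ≤ blk I (w p) := by
    intro b
    have himg : ∀ μ : Equiv.Perm (Fin n),
        (Finset.univ.filter fun p => b ≤ blk I (μ p)).card =
          (Finset.univ.filter fun a : Fin n => b ≤ blk I a).card := fun μ =>
      Finset.card_bij (fun p _ => μ p) (by simp) (by simp) fun a ha => ⟨μ⁻¹ a, by simpa using ha⟩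
    have hsub : (Finset.univ.filter fun p => b ≤ blk I (w p)) ⊆
        Finset.univ.filter fun p => b ≤ blk I (y p) := by
      intro p hp
      simp only [Finset.mem_filter, Finset.mem_univ, true_and] at hp ⊢
      have h1 := h b (p.1 + 1)
      -- As the blocks of `w` decrease, every position up to `p` counts. The rank is thus the
      -- largest possible, and `y` must attain it too.
      have h2 : rk (fun a => b ≤ blk I a) w (p.1 + 1) =
          (Finset.univ.filter fun q : Fin n => q.1 < p.1 + 1).card := by
        unfold rk
        congr 1
        refine Finset.filter_congr fun q _ => and_iff_left_of_imp fun hq => ?_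
        exact hp.trans (hw (Fin.le_def.2 (by omega)))
      have h3 := Finset.eq_of_subset_of_card_le
        (s := Finset.univ.filter fun q : Fin n => q.1 < p.1 + 1 ∧ b ≤ blk I (y q))
        (t := Finset.univ.filter fun q : Fin n => q.1 < p.1 + 1)
        (fun q hq => by rw [Finset.mem_filter_univ] at hq ⊢; exact hq.1) (h2 ▸ h1)
      have h4 := Finset.ext_iff.1 h3 p
      simpa using h4
    have heq := Finset.eq_of_subset_of_card_le hsub (by rw [himg, himg])
    intro p
    have := Finset.ext_iff.1 heq p
    simpa using this.symm
  exact le_antisymm ((key _ p).1 le_rfl) ((key _ p).2 le_rfl)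

/-- Elementary decreasing sort of values. -/
def sortLeft {n : ℕ} (i : Fin (n - 1)) (μ : Equiv.Perm (Fin n)) : Equiv.Perm (Fin n) :=
  if i ∈ Rec μ then μ else s i * μ

theorem sortDec_eq {n : ℕ} (i : Fin (n - 1)) (μ : Equiv.Perm (Fin n)) :
    sortDec i μ = if i ∈ Des μ then μ else μ * s i := by
  simp only [mem_Des, sortDec]

/-- The hypothesis says that the values at `i`, `i + 1` are not `j`, `j + 1` in some order;
otherwise exchanging `j` and `j + 1` cannot alter their comparison. -/
theorem mem_Des_s_mul {n : ℕ} {i j : Fin (n - 1)} {μ : Equiv.Perm (Fin n)}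
    (h : s j * μ ≠ μ * s i) : i ∈ Des (s j * μ) ↔ i ∈ Des μ := by
  have h1 : ¬ (μ (lo i) = lo j ∧ μ (hi i) = hi j) := fun ⟨h1, h2⟩ => h <| by
    rw [s, s, Equiv.mul_swap_eq_swap_mul, h1, h2]
  have h2 : ¬ (μ (lo i) = hi j ∧ μ (hi i) = lo j) := fun ⟨h1, h2⟩ => h <| by
    rw [s, s, Equiv.mul_swap_eq_swap_mul, h1, h2, Equiv.swap_comm]
  have hne : μ (lo i) ≠ μ (hi i) := fun e => (lo_lt_hi i).ne (μ.injective e)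
  simp only [mem_Des, Equiv.Perm.mul_apply, s, Equiv.swap_apply_def]
  generalize μ (lo i) = a at *
  generalize μ (hi i) = b at *
  simp only [lo, hi, Fin.ext_iff, Fin.lt_def, ne_eq] at *
  split_ifs <;> simp_all <;> omega

theorem mem_Rec_mul_s {n : ℕ} {i j : Fin (n - 1)} {μ : Equiv.Perm (Fin n)}
    (h : s j * μ ≠ μ * s i) : j ∈ Rec (μ * s i) ↔ j ∈ Rec μ := by
  have hi : (s i)⁻¹ = s i := Equiv.swap_inv _ _
  have hj : (s j)⁻¹ = s j := Equiv.swap_inv _ _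
  rw [Rec, mul_inv_rev, hi, mem_Des_s_mul, Rec]
  intro e
  apply h
  have := congrArg (·⁻¹) e
  simpa [mul_inv_rev, hi, hj] using this.symm

theorem mem_Rec_iff_mem_Des {n : ℕ} {i j : Fin (n - 1)} {μ : Equiv.Perm (Fin n)}
    (h : s j * μ = μ * s i) : j ∈ Rec μ ↔ i ∈ Des μ := by
  rw [s, s, Equiv.mul_swap_eq_swap_mul] at h
  have h := mul_right_cancel h
  have hne : μ (lo i) ≠ μ (hi i) := fun e => (lo_lt_hi i).ne (μ.injective e)
  have h1 := Equiv.congr_fun h (lo j)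
  have h2 := Equiv.congr_fun h (hi j)
  rw [Equiv.swap_apply_left] at h1
  rw [Equiv.swap_apply_right] at h2
  have hlt := lo_lt_hi j
  rw [Equiv.swap_apply_def] at h1 h2
  rw [mem_Rec, mem_Des]
  have hl : ∀ {a b}, μ a = b → μ⁻¹ b = a := 
    fun h => by rw [← h, Equiv.Perm.inv_def, Equiv.symm_apply_apply]
  have hlt' := lo_lt_hi i
  split_ifs at h1 with h3 h4
  · rw [hl h3.symm, hl h1.symm, ← h3, ← h1]
    exact ⟨fun h => absurd h hlt'.not_gt, fun h => absurd h hlt.not_gt⟩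
  · rw [hl h4.symm, hl h1.symm, ← h4, ← h1]
    exact ⟨fun _ => hlt, fun _ => hlt'⟩
  · exact absurd h1 hlt.ne'

/-- If the two exchanges coincide on `μ`, so do the two sorts; if not, neither exchange affects the
test made by the other. -/
theorem sortDec_sortLeft {n : ℕ} (i j : Fin (n - 1)) (μ : Equiv.Perm (Fin n)) :
    sortDec i (sortLeft j μ) = sortLeft j (sortDec i μ) := by
  by_cases h : s j * μ = μ * s i
  · have h1 := mem_Rec_iff_mem_Des h
    by_cases hi : i ∈ Des μ
    · simp [sortDec_eq, sortLeft, hi, h1.2 hi]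
    · have hj : j ∉ Rec μ := fun hj => hi (h1.1 hj)
      have h2 : j ∈ Rec (μ * s i) := h ▸ mem_Rec_s_mul.2 hj
      have h3 : i ∈ Des (μ * s i) := (mem_Rec_iff_mem_Des (by
        rw [← h, s_mul_s_mul, h, mul_assoc, s_mul_s, mul_one])).1 h2
      simp [sortDec_eq, sortLeft, hi, hj, h, h2, h3]
  · have h1 := mem_Des_s_mul h
    have h2 := mem_Rec_mul_s h
    by_cases hi : i ∈ Des μ <;> by_cases hj : j ∈ Rec μ <;>
      simp [sortDec_eq, sortLeft, hi, hj, h1, h2, mul_assoc]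

theorem sortL_sortLeft {n : ℕ} (L : List (Fin (n - 1))) (j : Fin (n - 1))
    (μ : Equiv.Perm (Fin n)) : sortL L (sortLeft j μ) = sortLeft j (sortL L μ) := by
  induction L generalizing μ with
  | nil => rfl
  | cons i L ih => rw [sortL_cons, sortL_cons, sortDec_sortLeft, ih]

theorem monotone_le_blk {n : ℕ} (I : Finset (Fin (n - 1))) (b : ℕ) :
    Monotone fun a => b ≤ blk I a := fun _ _ h hb => hb.trans (blk_mono I h)

theorem blk_sortL_eq {n : ℕ} {I : Finset (Fin (n - 1))} {L : List (Fin (n - 1))}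
    (hw : Antitone fun p => blk I (sortL L 1 p)) (μ : Equiv.Perm (Fin n)) (p : Fin n) :
    blk I (sortL L μ p) = blk I (sortL L 1 p) :=
  blk_eq_of_rk_le hw (fun b => rk_le_rk_sortL (monotone_le_blk I b) L
    (rk_one_le (monotone_le_blk I b) μ)) p

theorem mem_Rec_of_antitone {n : ℕ} {I : Finset (Fin (n - 1))} {w : Equiv.Perm (Fin n)}
    (hw : Antitone fun p => blk I (w p)) {i : Fin (n - 1)} (hi : i ∈ I) : i ∈ Rec w := by
  rw [mem_Rec]
  refine hw.reflect_lt ?_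
  simpa [Equiv.Perm.inv_def] using blk_lt hi

/-- A permutation which the list sorts to the same permutation as the identity lies in the Young
subgroup of the complement. -/
theorem mem_young_of_sortL_eq {n : ℕ} {I : Finset (Fin (n - 1))} {L : List (Fin (n - 1))}
    (hw : Antitone fun p => blk I (sortL L 1 p)) (hr : Rec (sortL L 1) ⊆ I)
    {ρ : Equiv.Perm (Fin n)} (h : sortL L ρ = sortL L 1) : ρ ∈ young Iᶜ := by
  induction ρ using perm_induction with
  | one => exact one_mem _
  | step i μ hi ih =>
    have h1 : sortLeft i μ = s i * μ := if_neg hi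
    rw [← h1, sortL_sortLeft] at h
    have h2 : i ∈ Rec (sortL L 1) := by
      rw [← h, sortLeft]
      split_ifs with h3
      · exact h3
      · exact mem_Rec_s_mul.2 h3
    have hI := hr h2
    refine mul_mem (s_mem_young (by simpa using hI)) (ih ?_)
    rw [sortLeft] at h
    split_ifs at h with h3
    · exact h
    · exfalso
      -- Here `sortL L 1 = s i * sortL L μ`, although both sorted permutations have the same blocks;
      -- but `i ∈ I` makes `s i` change a block.
      have h4 := blk_sortL_eq hw μ ((sortL L μ)⁻¹ (lo i))
      rw [← h, Equiv.Perm.mul_apply, Equiv.Perm.inv_def, Equiv.apply_symm_apply, s_lo] at h4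
      exact (blk_lt hI).ne h4

/-! ### Minimal coset representatives and exchanges of positions -/

theorem eq_of_blk_eq {n : ℕ} {I : Finset (Fin (n - 1))} {σ τ : Equiv.Perm (Fin n)}
    (hσ : Rec σ ⊆ I) (hτ : Rec τ ⊆ I) (h : ∀ p, blk I (σ p) = blk I (τ p)) : σ = τ :=
  inv_injective <| by ext ⟨p, q⟩; rw [mem_inv_iff_blk hσ, mem_inv_iff_blk hτ, h, h]

/-- If `σ` has no recoils outside `I` and two consecutive values in a common block, these are
exchanged by an elementary transposition. -/
theorem exists_s_mul_eq {n : ℕ} {I : Finset (Fin (n - 1))} {σ : Equiv.Perm (Fin n)}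
    (h : Rec σ ⊆ I) {i : Fin (n - 1)} (hb : blk I (σ (lo i)) = blk I (σ (hi i))) :
    ∃ j, j ∉ I ∧ s j * σ = σ * s i := by
  have hlt := lt_of_inv h (lo_lt_hi i) hb
  have h1 := Fin.lt_def.1 hlt
  have h2 := (σ (hi i)).2
  let j : Fin (n - 1) := ⟨(σ (lo i)).1, by omega⟩
  have hlo : σ (lo i) = lo j := rfl
  have hle : hi j ≤ σ (hi i) := by simp only [Fin.le_def, hi, j]; exact h1
  have hj : blk I (hi j) = blk I (lo j) := le_antisymm
    ((blk_mono I hle).trans (hlo ▸ hb.ge)) (blk_mono I (lo_lt_hi j).le)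
  have hI : j ∉ I := fun hI => (blk_lt hI).ne' hj
  have hhi : σ (hi i) = hi j := by
    by_contra hne
    have hlt' := lt_of_le_of_ne hle (Ne.symm hne)
    have hsymm : ∀ a, σ (σ.symm a) = a := σ.apply_symm_apply
    -- Otherwise the value `hi j` lies strictly between two values of its block, so its position
    -- would be strictly between `i` and `i + 1`.
    have c1 : lo i < σ.symm (hi j) := by
      by_contra hc
      have hc' := lt_of_le_of_ne (not_lt.1 hc) fun e => (lo_lt_hi j).ne'
        (by rw [← hsymm (hi j), e, hlo])
      have := lt_of_inv h hc' (by rw [hsymm, hj, hlo])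
      rw [hsymm, hlo] at this
      exact this.not_gt (lo_lt_hi j)
    have c2 : σ.symm (hi j) < hi i := by
      by_contra hc
      have hc' := lt_of_le_of_ne (not_lt.1 hc) fun e => hne (by rw [e, hsymm])
      have := lt_of_inv h hc' (by rw [hsymm, hj, ← hb, hlo])
      rw [hsymm] at this
      exact this.not_gt hlt'
    simp only [Fin.lt_def, lo, hi] at c1 c2
    omega
  exact ⟨j, hI, by rw [s, s, Equiv.mul_swap_eq_swap_mul, hlo, hhi]⟩

theorem Rec_mul_s_subset {n : ℕ} {I : Finset (Fin (n - 1))} {σ : Equiv.Perm (Fin n)}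
    (h : Rec σ ⊆ I) {i : Fin (n - 1)} (hb : blk I (σ (lo i)) ≠ blk I (σ (hi i))) :
    Rec (σ * s i) ⊆ I := by
  intro j hj
  by_contra hI
  refine hI (h ((mem_Rec_mul_s fun e => hb ?_).1 hj))
  have h1 := congrArg (fun μ : Equiv.Perm (Fin n) => blk I (μ (lo i))) e
  simpa [blk_young (s_mem_young hI), s_lo] using h1

/-- Inversion turns exchanges of positions into exchanges of values. This is the measure that grows
in `exists_sort`. -/
theorem card_inv_lt_card_inv_mul_s {n : ℕ} {σ : Equiv.Perm (Fin n)} {i : Fin (n - 1)}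
    (h : i ∉ Des σ) : (inv σ⁻¹).card < (inv (σ * s i)⁻¹).card := by
  have hi : (s i)⁻¹ = s i := Equiv.swap_inv _ _
  rw [mul_inv_rev, hi]
  exact Finset.card_lt_card (inv_ssubset_inv_s_mul (by rwa [Rec, inv_inv]))

/-! ### Linear operators and the modules `P I` -/

theorem op_comp {n : ℕ} (f g : Equiv.Perm (Fin n) → Equiv.Perm (Fin n)) :
    op f * op g = op fun μ => f (g μ) :=
  e.ext fun μ => by rw [Module.End.mul_apply, op_e, op_e, op_e]

theorem op_id {n : ℕ} : op (fun μ : Equiv.Perm (Fin n) => μ) = 1 :=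
  e.ext fun μ => by rw [op_e, Module.End.one_apply]

theorem op_mul_right_mem {n : ℕ} (σ : Equiv.Perm (Fin n)) :
    op (fun μ => μ * σ) ∈ subalgebraHS n := by
  induction σ using perm_induction with
  | one => simpa only [mul_one, op_id] using one_mem _
  | step i σ _ ih =>
    have h : op (fun μ => μ * (s i * σ)) = op (fun μ => μ * σ) * sigmaOp i := by
      rw [sigmaOp, op_comp]
      simp only [mul_assoc]
    rw [h]
    exact mul_mem ih (Algebra.subset_adjoin (Or.inl ⟨i, rfl⟩))

theorem op_sortL_mem {n : ℕ} (L : List (Fin (n - 1))) : op (sortL L) ∈ subalgebraHS n := by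
  induction L with
  | nil =>
    have h : op (sortL ([] : List (Fin (n - 1)))) = 1 := op_id
    rw [h]; exact one_mem _
  | cons i L ih =>
    have h : op (sortL (i :: L)) = op (sortL L) * piOp i := by rw [piOp, op_comp]; rfl
    rw [h]
    exact mul_mem ih (Algebra.subset_adjoin (Or.inr ⟨i, rfl⟩))

/-- Multiplication on the right by a permutation, as an element of the algebra. -/
noncomputable def rightHS {n : ℕ} (σ : Equiv.Perm (Fin n)) : HS n :=
  (⟨op fun μ => μ * σ, op_mul_right_mem σ⟩ : subalgebraHS n)

/-- Successive sorts, as an element of the algebra. -/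
noncomputable def sortHS {n : ℕ} (L : List (Fin (n - 1))) : HS n :=
  (⟨op (sortL L), op_sortL_mem L⟩ : subalgebraHS n)

theorem rightHS_smul {n : ℕ} (σ : Equiv.Perm (Fin n)) (x : V n) :
    rightHS σ • x = op (fun μ => μ * σ) x := rfl

theorem sortHS_smul {n : ℕ} (L : List (Fin (n - 1))) (x : V n) :
    sortHS L • x = op (sortL L) x := rfl

/-- The sign of a permutation as a complex number. -/
def sgn {n : ℕ} (ν : Equiv.Perm (Fin n)) : ℂ := ((Equiv.Perm.sign ν : ℤˣ) : ℤ)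

theorem sgn_mul {n : ℕ} (μ ν : Equiv.Perm (Fin n)) : sgn (μ * ν) = sgn μ * sgn ν := by
  simp [sgn]

theorem sgn_mul_self {n : ℕ} (ν : Equiv.Perm (Fin n)) : sgn ν * sgn ν = 1 := by
  unfold sgn
  rcases Int.units_eq_one_or (Equiv.Perm.sign ν) with h | h <;> simp [h]

theorem sgn_one {n : ℕ} : sgn (1 : Equiv.Perm (Fin n)) = 1 := by simp [sgn]

theorem sgn_s {n : ℕ} (i : Fin (n - 1)) : sgn (s i) = -1 := by simp [sgn, sign_s]

/-- The translate `v_I · σ`. -/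
noncomputable def vShift {n : ℕ} (I : Finset (Fin (n - 1))) (σ : Equiv.Perm (Fin n)) : V n :=
  op (fun ν => ν * σ) (vSet I)

theorem vPerm_eq {n : ℕ} (σ : Equiv.Perm (Fin n)) : vPerm σ = vShift (Rec σ) σ := rfl

open Classical in
theorem vShift_eq {n : ℕ} (I : Finset (Fin (n - 1))) (σ : Equiv.Perm (Fin n)) :
    vShift I σ = ∑ ν : young I, sgn ν.1 • e (ν.1 * σ) := by
  rw [vShift, vSet, map_sum, ← Finset.sum_subtype_of_mem (p := fun ν => ν ∈ young I)
    (s := Finset.univ.filter fun ν => ν ∈ young I)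
    (f := fun ν => op (fun ν => ν * σ) ((((Equiv.Perm.sign ν : ℤˣ) : ℤ) : ℂ) • e ν))
    (fun ν h => (Finset.mem_filter_univ _).1 h)]
  refine Finset.sum_congr (by ext; simp) fun ν _ => ?_
  rw [map_smul, op_e, sgn]

theorem rightHS_smul_vShift {n : ℕ} (I : Finset (Fin (n - 1))) (σ τ : Equiv.Perm (Fin n)) :
    rightHS τ • vShift I σ = vShift I (σ * τ) := by
  classical
  simp only [rightHS_smul, vShift_eq, map_sum, map_smul, op_e, mul_assoc]

theorem vShift_mul {n : ℕ} {I : Finset (Fin (n - 1))} {ν : Equiv.Perm (Fin n)}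
    (h : ν ∈ young I) (σ : Equiv.Perm (Fin n)) : vShift I (ν * σ) = sgn ν • vShift I σ := by
  classical
  rw [vShift_eq, vShift_eq, Finset.smul_sum]
  refine Fintype.sum_equiv (Equiv.mulRight (⟨ν, h⟩ : young I)) _ _ fun μ => ?_
  have : sgn ν * (sgn μ.1 * sgn ν) = sgn μ.1 := by
    rw [mul_left_comm, sgn_mul_self, mul_one]
  simp [sgn_mul, smul_smul, this, mul_assoc]

theorem op_mul_left_vShift {n : ℕ} {I : Finset (Fin (n - 1))} {ν : Equiv.Perm (Fin n)}
    (h : ν ∈ young I) (σ : Equiv.Perm (Fin n)) :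
    op (fun μ => ν * μ) (vShift I σ) = sgn ν • vShift I σ := by
  classical
  simp only [vShift_eq, map_sum, map_smul, op_e, Finset.smul_sum]
  refine Fintype.sum_equiv (Equiv.mulLeft (⟨ν, h⟩ : young I)) _ _ fun μ => ?_
  have : sgn ν * (sgn ν * sgn μ.1) = sgn μ.1 := by
    rw [← mul_assoc, sgn_mul_self, one_mul]
  simp [sgn_mul, smul_smul, this, mul_assoc]

theorem mem_P {n : ℕ} {I : Finset (Fin (n - 1))} {x : V n} :
    x ∈ P I ↔ ∀ i, i ∉ I → sigmaBar i x = -x := by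
  refine forall₂_congr fun i _ => ?_
  rw [LinearMap.mem_ker, LinearMap.add_apply, Module.End.one_apply, add_comm,
    add_eq_zero_iff_eq_neg]

theorem vShift_mem_P {n : ℕ} (I : Finset (Fin (n - 1))) (σ : Equiv.Perm (Fin n)) :
    vShift I σ ∈ P I := mem_P.2 fun i hi => by
  rw [sigmaBar, op_mul_left_vShift (s_mem_young hi), sgn_s, neg_one_smul]

theorem vPerm_mem_P {n : ℕ} (σ : Equiv.Perm (Fin n)) : vPerm σ ∈ P (Rec σ) :=
  vShift_mem_P _ σ

theorem op_mul_left_of_mem_P {n : ℕ} {I : Finset (Fin (n - 1))} {x : V n} (hx : x ∈ P I)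
    {ν : Equiv.Perm (Fin n)} (h : ν ∈ young I) : op (fun μ => ν * μ) x = sgn ν • x := by
  induction h using Subgroup.closure_induction with
  | mem t ht =>
    obtain ⟨i, hi, rfl⟩ := ht
    rw [sgn_s, neg_one_smul, ← mem_P.1 hx i hi, sigmaBar]
  | one => simp only [one_mul, op_id, sgn_one, one_smul, Module.End.one_apply]
  | mul a b _ _ ha hb =>
    have h : op (fun μ => a * b * μ) = op (fun μ => a * μ) * op (fun μ => b * μ) := by
      rw [op_comp]; simp only [mul_assoc]
    rw [h, Module.End.mul_apply, hb, map_smul, ha, smul_smul, sgn_mul, mul_comm]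
  | inv a _ ha =>
    have h : op (fun μ => a⁻¹ * μ) * op (fun μ => a * μ) = 1 := by
      rw [op_comp]; simp only [inv_mul_cancel_left, op_id]
    have h2 : sgn a⁻¹ = sgn a := by simp [sgn]
    have h3 := LinearMap.congr_fun h x
    rw [Module.End.mul_apply, ha, map_smul, Module.End.one_apply] at h3
    rw [h2, ← h3, smul_smul, sgn_mul_self, one_smul, h3]

/-- The antisymmetrizer `A` of `young I` is multiplication by the order of `young I` on `P I`, and
it sends `μ` to `v_I · μ`, which is up to sign the translate by the minimal representative. -/
theorem P_le_span_vShift {n : ℕ} {I : Finset (Fin (n - 1))} {x : V n} (hx : x ∈ P I) :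
    x ∈ Submodule.span ℂ (Set.range fun σ : {σ : Equiv.Perm (Fin n) // Rec σ ⊆ I} =>
      vShift I σ.1) := by
  classical
  let A : Module.End ℂ (V n) := ∑ ν : young I, sgn ν.1 • op fun μ => ν.1 * μ
  have hA : ∀ μ, A (e μ) = vShift I μ := fun μ => by
    simp [A, LinearMap.sum_apply, op_e, vShift_eq]
  have hx1 : A x = (Fintype.card (young I) : ℂ) • x := by
    simp only [A, LinearMap.sum_apply, LinearMap.smul_apply]
    rw [Finset.sum_congr rfl fun ν _ => by
      rw [op_mul_left_of_mem_P hx ν.2, smul_smul, sgn_mul_self, one_smul]]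
    simp [Nat.cast_smul_eq_nsmul]
  have hc : (Fintype.card (young I) : ℂ) ≠ 0 := Nat.cast_ne_zero.2 Fintype.card_ne_zero
  rw [← inv_smul_smul₀ hc x, ← hx1, ← e.sum_repr x, map_sum]
  refine Submodule.smul_mem _ _ (Submodule.sum_mem _ fun μ _ => ?_)
  rw [map_smul, hA]
  obtain ⟨ν, hν, σ, hσ, rfl⟩ := exists_young_mul I μ
  rw [vShift_mul hν]
  exact Submodule.smul_mem _ _ (Submodule.smul_mem _ _ (Submodule.subset_span ⟨⟨σ, hσ⟩, rfl⟩))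

/-! ### Triangularity and the bases of `P I` and `S I` -/

theorem inv_subset_of_repr_vShift {n : ℕ} {I : Finset (Fin (n - 1))} {σ τ : Equiv.Perm (Fin n)}
    (hσ : Rec σ ⊆ I) (h : e.repr (vShift I σ) τ ≠ 0) : inv σ ⊆ inv τ := by
  classical
  rw [vShift_eq, map_sum, Finsupp.finsetSum_apply] at h
  obtain ⟨ν, -, hν⟩ := Finset.exists_ne_zero_of_sum_ne_zero h
  rw [map_smul, e.repr_self, Finsupp.smul_apply, Finsupp.single_apply] at hν
  split_ifs at hν with h1
  · exact h1 ▸ inv_subset_inv_mul hσ ν.2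
  · simp at hν

theorem repr_vShift_self {n : ℕ} (I : Finset (Fin (n - 1))) (σ : Equiv.Perm (Fin n)) :
    e.repr (vShift I σ) σ = 1 := by
  classical
  rw [vShift_eq, map_sum, Finsupp.finsetSum_apply, Finset.sum_eq_single 1]
  · simp [sgn_one]
  · intro ν _ hν
    have : ν.1 * σ ≠ σ := fun h => hν (Subtype.ext (mul_eq_right.1 h))
    simp [this]
  · simp

theorem linearIndependent_vPerm {n : ℕ} :
    LinearIndependent ℂ (vPerm : Equiv.Perm (Fin n) → V n) := by
  classical
  rw [Fintype.linearIndependent_iff]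
  intro c hc
  by_contra! hne
  -- By triangularity, `σ₀` occurs in no other `v_σ` that has a nonzero coefficient.
  obtain ⟨σ₀, h₀, hmin⟩ := Finset.exists_min_image (Finset.univ.filter fun σ => c σ ≠ 0)
    (fun σ => (inv σ).card) (hne.imp fun σ h => (Finset.mem_filter_univ _).2 h)
  rw [Finset.mem_filter_univ] at h₀
  have h1 := congrArg (fun x => e.repr x σ₀) hc
  simp only [map_sum, map_smul, Finsupp.finsetSum_apply, Finsupp.smul_apply, map_zero,
    Finsupp.zero_apply, smul_eq_mul] at h1
  rw [Finset.sum_eq_single σ₀, vPerm_eq, repr_vShift_self, mul_one] at h1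
  · exact h₀ h1
  · intro σ _ hσ
    by_contra h
    obtain ⟨h2, h3⟩ := mul_ne_zero_iff.1 h
    have h4 := inv_subset_of_repr_vShift subset_rfl h3
    exact hσ (inv_injective (Finset.eq_of_subset_of_card_le h4
      (hmin σ ((Finset.mem_filter_univ _).2 h2))))
  · simp

instance {n : ℕ} : Module.Finite ℂ (V n) := Module.Finite.of_basis e

/-- The basis of `V n` consisting of the vectors `v_σ`. -/
noncomputable def vBasis {n : ℕ} : Module.Basis (Equiv.Perm (Fin n)) ℂ (V n) :=
  basisOfLinearIndependentOfCardEqFinrank linearIndependent_vPerm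
    (Module.finrank_eq_card_basis e).symm

theorem vBasis_apply {n : ℕ} (σ : Equiv.Perm (Fin n)) : vBasis σ = vPerm σ := by
  simp [vBasis]

/-- The independent `v_σ` with `Rec σ ⊆ I` lie in `P I` and are as many as the translates spanning
it. -/
theorem mem_P_iff {n : ℕ} {I : Finset (Fin (n - 1))} {x : V n} :
    x ∈ P I ↔ ∀ σ, vBasis.repr x σ ≠ 0 → Rec σ ⊆ I := by
  constructor
  · intro hx
    let v : {σ : Equiv.Perm (Fin n) // Rec σ ⊆ I} → V n := fun σ => vPerm σ.1
    have hle : Submodule.span ℂ (Set.range v) ≤ (P I).restrictScalars ℂ := by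
      rw [Submodule.span_le]
      rintro _ ⟨σ, rfl⟩
      exact P_mono σ.2 (vPerm_mem_P σ.1)
    have h1 : Module.finrank ℂ (Submodule.span ℂ (Set.range v)) = Fintype.card _ :=
      finrank_span_eq_card (linearIndependent_vPerm.comp _ Subtype.val_injective)
    have h2 : Module.finrank ℂ ((P I).restrictScalars ℂ) ≤
        Fintype.card {σ : Equiv.Perm (Fin n) // Rec σ ⊆ I} :=
      (Submodule.finrank_mono (s := (P I).restrictScalars ℂ) fun y (hy : y ∈ P I) =>
        P_le_span_vShift hy).trans (finrank_range_le_card _)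
    have h3 := Submodule.eq_of_le_of_finrank_le hle (h1 ▸ h2)
    have h4 : x ∈ Submodule.span ℂ (Set.range v) := h3 ▸ hx
    have h5 : Set.range v = vBasis '' {σ | Rec σ ⊆ I} := by
      ext y
      simp [v, vBasis_apply]
    rw [h5, vBasis.mem_span_image] at h4
    exact fun σ hσ => h4 (Finsupp.mem_support_iff.2 hσ)
  · intro h
    rw [← vBasis.sum_repr x]
    refine Submodule.sum_mem _ fun σ _ => ?_
    by_cases h0 : vBasis.repr x σ = 0
    · rw [h0, zero_smul]; exact zero_mem _
    · rw [vBasis_apply]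
      exact Submodule.smul_of_tower_mem _ _ (P_mono (h σ h0) (vPerm_mem_P σ))

theorem mem_iSup_P_iff {n : ℕ} {I : Finset (Fin (n - 1))} {x : V n} :
    x ∈ (⨆ J : Finset (Fin (n - 1)), ⨆ _ : J ⊂ I, P J) ↔
      ∀ σ, vBasis.repr x σ ≠ 0 → Rec σ ⊂ I := by
  constructor
  · intro hx
    let U : Submodule ℂ (V n) := Submodule.span ℂ (vBasis '' {σ | Rec σ ⊂ I})
    have hU : ∀ {y}, y ∈ U ↔ ∀ σ, vBasis.repr y σ ≠ 0 → Rec σ ⊂ I := fun {y} => by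
      rw [vBasis.mem_span_image]
      simp [Set.subset_def]
    rw [← hU]
    induction hx using Submodule.iSup_induction' with
    | mem J y hy =>
      by_cases hJ : J ⊂ I
      · rw [iSup_pos hJ] at hy
        exact hU.2 fun σ hσ => (mem_P_iff.1 hy σ hσ).trans_ssubset hJ
      · rw [iSup_neg hJ, Submodule.mem_bot] at hy
        exact hy ▸ zero_mem _
    | zero => exact zero_mem _
    | add y z _ _ hy hz => exact add_mem hy hz
  · intro h
    rw [← vBasis.sum_repr x]
    refine Submodule.sum_mem _ fun σ _ => ?_
    by_cases h0 : vBasis.repr x σ = 0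
    · rw [h0, zero_smul]; exact zero_mem _
    · rw [vBasis_apply]
      exact Submodule.smul_of_tower_mem _ _
        (Submodule.mem_iSup_of_mem _ (Submodule.mem_iSup_of_mem (h σ h0) (vPerm_mem_P σ)))

theorem mem_sumBelow_iff {n : ℕ} {I : Finset (Fin (n - 1))} {x : P I} :
    x ∈ sumBelow I ↔ ∀ σ, Rec σ = I → vBasis.repr x.1 σ = 0 := by
  have h : x ∈ sumBelow I ↔ x.1 ∈ (⨆ J : Finset (Fin (n - 1)), ⨆ _ : J ⊂ I, P J) := Iff.rfl
  rw [h, mem_iSup_P_iff]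
  refine forall_congr' fun σ => ⟨fun h hI => ?_, fun h h0 => ?_⟩
  · by_contra h0
    exact (h h0).ne hI
  · exact (mem_P_iff.1 x.2 σ h0).ssubset_of_ne fun hI => h0 (h hI)

theorem vPerm_not_mem_sumBelow {n : ℕ} {I : Finset (Fin (n - 1))} {σ : Equiv.Perm (Fin n)}
    (h : Rec σ = I) (hσ : vPerm σ ∈ P I) : ⟨vPerm σ, hσ⟩ ∉ sumBelow I := fun hm => by
  have := mem_sumBelow_iff.1 hm σ h
  simp [← vBasis_apply] at this

theorem linearIndependent_proj {n : ℕ} (I : Finset (Fin (n - 1)))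
    (h : ∀ σ : {σ : Equiv.Perm (Fin n) // Rec σ = I}, vPerm σ.1 ∈ P I) :
    LinearIndependent ℂ fun σ : {σ : Equiv.Perm (Fin n) // Rec σ = I} =>
      proj I ⟨vPerm σ.1, h σ⟩ := by
  classical
  rw [Fintype.linearIndependent_iff]
  intro c hc τ
  have h1 : proj I (∑ σ, c σ • ⟨vPerm σ.1, h σ⟩) = 0 := by
    rw [map_sum, ← hc]
    rfl
  have h2 := mem_sumBelow_iff.1 ((Submodule.Quotient.mk_eq_zero _).1 h1) τ.1 τ.2
  have h3 : ((∑ σ, c σ • (⟨vPerm σ.1, h σ⟩ : P I) : P I) : V n) = ∑ σ, c σ • vBasis σ.1 := by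
    rw [Submodule.coe_sum]
    simp only [vBasis_apply]
    rfl
  rw [h3, map_sum, Finsupp.finsetSum_apply, Finset.sum_eq_single τ] at h2
  · simpa using h2
  · intro σ _ hσ
    have : σ.1 ≠ τ.1 := fun e => hσ (Subtype.ext e)
    simp [this]
  · simp

theorem sub_sum_mem_sumBelow {n : ℕ} {I : Finset (Fin (n - 1))} (x : P I)
    (h : ∀ σ : {σ : Equiv.Perm (Fin n) // Rec σ = I}, vPerm σ.1 ∈ P I) :
    x - ∑ σ : {σ : Equiv.Perm (Fin n) // Rec σ = I},
      vBasis.repr x.1 σ.1 • (⟨vPerm σ.1, h σ⟩ : P I) ∈ sumBelow I := by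
  classical
  refine mem_sumBelow_iff.2 fun τ hτ => ?_
  have h3 : ((∑ σ : {σ : Equiv.Perm (Fin n) // Rec σ = I},
      vBasis.repr x.1 σ.1 • (⟨vPerm σ.1, h σ⟩ : P I) : P I) : V n) =
        ∑ σ : {σ : Equiv.Perm (Fin n) // Rec σ = I}, vBasis.repr x.1 σ.1 • vBasis σ.1 := by
    rw [Submodule.coe_sum]
    simp only [vBasis_apply]
    rfl
  rw [Submodule.coe_sub, h3, map_sub, Finsupp.sub_apply, map_sum, Finsupp.finsetSum_apply,
    Finset.sum_eq_single ⟨τ, hτ⟩]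
  · simp
  · intro σ _ hσ
    have : σ.1 ≠ τ := fun e => hσ (Subtype.ext e)
    simp [this]
  · simp

theorem span_proj {n : ℕ} (I : Finset (Fin (n - 1)))
    (h : ∀ σ : {σ : Equiv.Perm (Fin n) // Rec σ = I}, vPerm σ.1 ∈ P I) :
    ⊤ ≤ Submodule.span ℂ (Set.range fun σ : {σ : Equiv.Perm (Fin n) // Rec σ = I} =>
      proj I ⟨vPerm σ.1, h σ⟩) := by
  rintro x -
  obtain ⟨x, rfl⟩ := Submodule.mkQ_surjective _ x
  change proj I x ∈ _
  have h1 := (Submodule.Quotient.eq _).2 (sub_sum_mem_sumBelow x h)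
  change proj I x = proj I _ at h1
  rw [h1, map_sum]
  refine Submodule.sum_mem _ fun σ _ => ?_
  have h2 := Submodule.smul_mem _ (vBasis.repr x.1 σ.1) (Submodule.subset_span (R := ℂ)
    (Set.mem_range_self (f := fun σ : {σ : Equiv.Perm (Fin n) // Rec σ = I} =>
      proj I ⟨vPerm σ.1, h σ⟩) σ))
  exact h2

/-! ### Sorting the translates of `v_I` -/

theorem piOp_vShift_of_mem_Des {n : ℕ} {I : Finset (Fin (n - 1))} {σ : Equiv.Perm (Fin n)}
    (h : Rec σ ⊆ I) {i : Fin (n - 1)} (hd : i ∈ Des σ) :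
    piOp i (vShift I σ) = vShift I σ := by
  classical
  simp only [piOp, vShift_eq, map_sum, map_smul, op_e]
  refine Finset.sum_congr rfl fun ν _ => ?_
  have h1 : (lo i, hi i) ∈ inv σ := mem_inv.2 ⟨lo_lt_hi i, mem_Des.1 hd⟩
  have h2 := inv_subset_inv_mul h ν.2 h1
  rw [sortDec, if_pos (mem_inv.1 h2).2]

theorem piOp_vShift_of_blk_lt {n : ℕ} {I : Finset (Fin (n - 1))} {σ : Equiv.Perm (Fin n)}
    {i : Fin (n - 1)} (hb : blk I (σ (lo i)) < blk I (σ (hi i))) :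
    piOp i (vShift I σ) = vShift I (σ * s i) := by
  classical
  simp only [piOp, vShift_eq, map_sum, map_smul, op_e]
  refine Finset.sum_congr rfl fun ν _ => ?_
  have h2 : (ν.1 * σ) (lo i) < (ν.1 * σ) (hi i) := (blk_mono I).reflect_lt <| by
    simpa [blk_young ν.2] using hb
  rw [sortDec, if_neg h2.not_gt, mul_assoc]

theorem sortDec_mul_s {n : ℕ} (i : Fin (n - 1)) (μ : Equiv.Perm (Fin n)) :
    sortDec i (μ * s i) = sortDec i μ := by
  have hne : μ (lo i) ≠ μ (hi i) := fun e => (lo_lt_hi i).ne (μ.injective e)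
  rw [sortDec, sortDec, Equiv.Perm.mul_apply, Equiv.Perm.mul_apply, s_lo, s_hi, mul_assoc,
    s_mul_s, mul_one]
  rcases lt_or_gt_of_ne hne with h | h
  · rw [if_pos h, if_neg h.not_gt]
  · rw [if_pos h, if_neg h.not_gt]

/-- Here `σ * s i = s j * σ` with `j ∉ I`, so exchanging the positions negates `v_I · σ`; but the
sort does not see the exchange. -/
theorem piOp_vShift_of_blk_eq {n : ℕ} {I : Finset (Fin (n - 1))} {σ : Equiv.Perm (Fin n)}
    (h : Rec σ ⊆ I) {i : Fin (n - 1)} (hb : blk I (σ (lo i)) = blk I (σ (hi i))) :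
    piOp i (vShift I σ) = 0 := by
  obtain ⟨j, hj, e⟩ := exists_s_mul_eq h hb
  have h1 : piOp i (vShift I (σ * s i)) = piOp i (vShift I σ) := by
    classical
    simp only [piOp, vShift_eq, map_sum, map_smul, op_e, ← mul_assoc, sortDec_mul_s]
  rw [← e, vShift_mul (s_mem_young hj), sgn_s, map_smul, neg_one_smul] at h1
  have h2 : (2 : ℂ) • piOp i (vShift I σ) = 0 := by
    rw [two_smul]
    exact neg_eq_iff_add_eq_zero.1 h1
  exact (smul_eq_zero.1 h2).resolve_left two_ne_zero

theorem piOp_vShift {n : ℕ} {I : Finset (Fin (n - 1))} {σ : Equiv.Perm (Fin n)}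
    (h : Rec σ ⊆ I) (i : Fin (n - 1)) :
    piOp i (vShift I σ) = 0 ∨
      (piOp i (vShift I σ) = vShift I (sortDec i σ) ∧ Rec (sortDec i σ) ⊆ I) := by
  by_cases hd : i ∈ Des σ
  · right
    rw [sortDec_eq, if_pos hd]
    exact ⟨piOp_vShift_of_mem_Des h hd, h⟩
  · by_cases hb : blk I (σ (lo i)) = blk I (σ (hi i))
    · exact Or.inl (piOp_vShift_of_blk_eq h hb)
    · right
      rw [sortDec_eq, if_neg hd]
      rw [mem_Des, not_lt] at hd
      exact ⟨piOp_vShift_of_blk_lt ((blk_mono I hd).lt_of_ne hb), Rec_mul_s_subset h hb⟩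

theorem op_sortL_cons {n : ℕ} (i : Fin (n - 1)) (L : List (Fin (n - 1))) (x : V n) :
    op (sortL (i :: L)) x = op (sortL L) (piOp i x) := by
  rw [piOp, ← Module.End.mul_apply, op_comp]
  rfl

theorem op_sortL_append {n : ℕ} (L : List (Fin (n - 1))) (i : Fin (n - 1)) (x : V n) :
    op (sortL (L ++ [i])) x = piOp i (op (sortL L) x) := by
  rw [piOp, ← Module.End.mul_apply, op_comp]
  simp only [← sortL_append]

theorem op_sortL_vShift {n : ℕ} {I : Finset (Fin (n - 1))} (L : List (Fin (n - 1)))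
    {σ : Equiv.Perm (Fin n)} (h : Rec σ ⊆ I) :
    op (sortL L) (vShift I σ) = 0 ∨
      (op (sortL L) (vShift I σ) = vShift I (sortL L σ) ∧ Rec (sortL L σ) ⊆ I) := by
  induction L generalizing σ with
  | nil => exact Or.inr ⟨LinearMap.congr_fun op_id _, h⟩
  | cons i L ih =>
    rw [op_sortL_cons, sortL_cons]
    rcases piOp_vShift h i with h1 | ⟨h1, h2⟩
    · left; rw [h1, map_zero]
    · rw [h1]; exact ih h2

theorem Rec_one {n : ℕ} : Rec (1 : Equiv.Perm (Fin n)) = ∅ :=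
  Finset.eq_empty_of_forall_notMem fun i hi => by
    rw [mem_Rec, inv_one] at hi
    exact hi.not_gt (lo_lt_hi i)

/-- A sequence of sorts which brings `v_I` to the translate of `v_I` by the longest permutation
with recoil set `I`. -/
theorem exists_sort {n : ℕ} (I : Finset (Fin (n - 1))) :
    ∃ L : List (Fin (n - 1)), Antitone (fun p => blk I (sortL L 1 p)) ∧ Rec (sortL L 1) = I ∧
      op (sortL L) (vShift I 1) = vShift I (sortL L 1) := by
  let good : Equiv.Perm (Fin n) → Prop := fun w => ∃ L : List (Fin (n - 1)), sortL L 1 = w ∧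
    Rec w ⊆ I ∧ op (sortL L) (vShift I 1) = vShift I w
  have hgood : good 1 := ⟨[], rfl, by simp [Rec_one], LinearMap.congr_fun op_id _⟩
  classical
  -- Take a reachable `w` of maximal length: a rise of blocks between neighbouring positions would
  -- allow one more sort, lengthening it.
  obtain ⟨w, hw, hmax⟩ := Finset.exists_max_image (Finset.univ.filter good)
    (fun w => (inv w⁻¹).card) ⟨1, (Finset.mem_filter_univ _).2 hgood⟩
  rw [Finset.mem_filter_univ] at hw
  obtain ⟨L, rfl, hr, hL⟩ := hw
  have hstep : ∀ i, blk I (sortL L 1 (hi i)) ≤ blk I (sortL L 1 (lo i)) := fun i => by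
    by_contra hc
    rw [not_le] at hc
    have hd : i ∉ Des (sortL L 1) := fun hd =>
      hc.not_ge (blk_mono I (mem_Des.1 hd).le)
    refine (card_inv_lt_card_inv_mul_s hd).not_ge (hmax _ ((Finset.mem_filter_univ _).2
      ⟨L ++ [i], ?_, Rec_mul_s_subset hr hc.ne, ?_⟩))
    · rw [sortL_append, sortDec_eq, if_neg hd]
    · rw [op_sortL_append, hL, piOp_vShift_of_blk_lt hc]
  have hanti : Antitone fun p => blk I (sortL L 1 p) := fun a b hab => by
    rcases hab.eq_or_lt with rfl | hab
    · exact le_rfl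
    -- For the empty set there is a single block, so the relation passes from neighbours to all
    -- pairs.
    · exact rel_of_adjacent ∅ (fun a b => blk I (sortL L 1 b) ≤ blk I (sortL L 1 a))
        (fun _ _ _ h1 h2 => h2.trans h1) (fun i _ => hstep i) hab (by rw [blk_empty, blk_empty])
  exact ⟨L, hanti, hr.antisymm fun i hi => mem_Rec_of_antitone hanti hi, hL⟩

/-- Write `μ = ν * ρ` with `ρ` minimal. If `v_I · ρ` survives, `ρ` is sorted to a minimal
representative with the blocks of `sortL L 1`, hence to `sortL L 1` itself. -/
theorem op_sortL_vShift_of_ne_zero {n : ℕ} {I : Finset (Fin (n - 1))} {L : List (Fin (n - 1))}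
    (hw : Antitone fun p => blk I (sortL L 1 p)) (hr : Rec (sortL L 1) = I)
    {μ : Equiv.Perm (Fin n)} (h : op (sortL L) (vShift I μ) ≠ 0) :
    ∃ ν ∈ young I, ∃ ρ ∈ young Iᶜ, μ = ν * ρ := by
  obtain ⟨ν, hν, ρ, hρ, rfl⟩ := exists_young_mul I μ
  refine ⟨ν, hν, ρ, ?_, rfl⟩
  rw [vShift_mul hν, map_smul] at h
  rcases op_sortL_vShift L hρ with h1 | ⟨-, h2⟩
  · rw [h1, smul_zero] at h
    exact absurd rfl h
  · exact mem_young_of_sortL_eq hw hr.subset (eq_of_blk_eq h2 hr.subset (blk_sortL_eq hw ρ))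

/-- Survival would give `ν⁻¹ * τ = ρ * σ`. As `τ` is minimal for `young I` and `σ` maximal for
`young Iᶜ`, `inv τ ⊆ inv σ`, so the count forces `τ = σ`. -/
theorem op_sortL_vShift_mul_inv {n : ℕ} {I : Finset (Fin (n - 1))} {L : List (Fin (n - 1))}
    (hw : Antitone fun p => blk I (sortL L 1 p)) (hr : Rec (sortL L 1) = I)
    {σ τ : Equiv.Perm (Fin n)} (hσ : Rec σ = I) (hτ : Rec τ = I) (hne : τ ≠ σ)
    (hle : (inv σ).card ≤ (inv τ).card) : op (sortL L) (vShift I (τ * σ⁻¹)) = 0 := by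
  by_contra h
  obtain ⟨ν, hν, ρ, hρ, e⟩ := op_sortL_vShift_of_ne_zero hw hr h
  have e2 : ν⁻¹ * τ = ρ * σ := by
    rw [inv_mul_eq_iff_eq_mul, ← mul_assoc, ← e, inv_mul_cancel_right]
  have h1 : inv τ ⊆ inv (ν⁻¹ * τ) := inv_subset_inv_mul hτ.subset (inv_mem hν)
  have h2 : inv (ρ * σ) ⊆ inv σ :=
    inv_mul_subset_inv (fun i hi => by simpa [hσ] using hi) hρ
  rw [e2] at h1
  exact hne (inv_injective (Finset.eq_of_subset_of_card_le (h1.trans h2) hle))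

/-! ### Simplicity and pairwise non-isomorphism -/

theorem P_le_of_vShift_mem {n : ℕ} {I : Finset (Fin (n - 1))} {N : Submodule (HS n) (V n)}
    {σ : Equiv.Perm (Fin n)} (h : vShift I σ ∈ N) : P I ≤ N := by
  intro x hx
  have h1 : Submodule.span ℂ (Set.range fun σ : {σ : Equiv.Perm (Fin n) // Rec σ ⊆ I} =>
      vShift I σ.1) ≤ N.restrictScalars ℂ := by
    rw [Submodule.span_le]
    rintro _ ⟨τ, rfl⟩
    have := N.smul_mem (rightHS (σ⁻¹ * τ.1)) h
    rwa [rightHS_smul_vShift, mul_inv_cancel_left] at this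
  exact h1 (P_le_span_vShift hx)

theorem sumBelow_ne_top {n : ℕ} (I : Finset (Fin (n - 1))) : sumBelow I ≠ ⊤ := by
  obtain ⟨L, -, hr, -⟩ := exists_sort I
  have hP : vPerm (sortL L 1) ∈ P I := by
    have := vPerm_mem_P (sortL L 1)
    rwa [hr] at this
  exact fun h => vPerm_not_mem_sumBelow hr hP (h ▸ Submodule.mem_top)

theorem isCoatom_sumBelow {n : ℕ} (I : Finset (Fin (n - 1))) : IsCoatom (sumBelow I) := by
  refine ⟨sumBelow_ne_top I, fun N hN => ?_⟩
  classical
  obtain ⟨x, hxN, hx⟩ := SetLike.exists_of_lt hN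
  have hv : ∀ σ : {σ : Equiv.Perm (Fin n) // Rec σ = I}, vPerm σ.1 ∈ P I := fun σ => by
    have := vPerm_mem_P σ.1
    rwa [σ.2] at this
  have hex : ∃ σ : {σ : Equiv.Perm (Fin n) // Rec σ = I}, vBasis.repr x.1 σ.1 ≠ 0 := by
    by_contra! h
    exact hx (mem_sumBelow_iff.2 fun σ hσ => h ⟨σ, hσ⟩)
  obtain ⟨σ₀, h₀, hmin⟩ := Finset.exists_min_image
    (Finset.univ.filter fun σ : {σ : Equiv.Perm (Fin n) // Rec σ = I} => vBasis.repr x.1 σ.1 ≠ 0)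
    (fun σ => (inv σ.1).card) (hex.imp fun σ h => (Finset.mem_filter_univ _).2 h)
  rw [Finset.mem_filter_univ] at h₀
  obtain ⟨L, hw, hr, hL⟩ := exists_sort I
  set y : P I := ∑ σ : {σ : Equiv.Perm (Fin n) // Rec σ = I},
    vBasis.repr x.1 σ.1 • (⟨vPerm σ.1, hv σ⟩ : P I) with hy
  have hyN : y ∈ N := by
    have h1 := N.sub_mem hxN (hN.le (sub_sum_mem_sumBelow x hv))
    rwa [sub_sub_cancel] at h1
  have hyV : y.1 = ∑ σ : {σ : Equiv.Perm (Fin n) // Rec σ = I},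
      vBasis.repr x.1 σ.1 • vShift I σ.1 := by
    rw [hy, Submodule.coe_sum]
    refine Finset.sum_congr rfl fun σ _ => ?_
    change vBasis.repr x.1 σ.1 • vPerm σ.1 = _
    rw [vPerm_eq, σ.2]
  -- Minimality of `σ₀` makes the sorts kill every other term of the translated sum.
  have hz : (sortHS L • rightHS σ₀.1⁻¹ • y : P I).1 =
      vBasis.repr x.1 σ₀.1 • vShift I (sortL L 1) := by
    change sortHS L • rightHS σ₀.1⁻¹ • y.1 = _
    rw [hyV, rightHS_smul, sortHS_smul, map_sum, map_sum, Finset.sum_eq_single σ₀]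
    · rw [map_smul, map_smul, ← rightHS_smul, rightHS_smul_vShift, mul_inv_cancel, hL]
    · intro σ _ hσ
      rw [map_smul, map_smul, ← rightHS_smul, rightHS_smul_vShift]
      by_cases h : vBasis.repr x.1 σ.1 = 0
      · rw [h, zero_smul]
      · rw [op_sortL_vShift_mul_inv hw hr σ₀.2 σ.2 (fun e => hσ (Subtype.ext e))
          (hmin σ ((Finset.mem_filter_univ _).2 h)), smul_zero]
    · simp
  have hN' : vShift I (sortL L 1) ∈ N.map (P I).subtype := by
    refine ⟨(vBasis.repr x.1 σ₀.1)⁻¹ • sortHS L • rightHS σ₀.1⁻¹ • y,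
      Submodule.smul_of_tower_mem _ _ (N.smul_mem _ (N.smul_mem _ hyN)), ?_⟩
    change (vBasis.repr x.1 σ₀.1)⁻¹ • (sortHS L • rightHS σ₀.1⁻¹ • y : P I).1 = _
    rw [hz, inv_smul_smul₀ h₀]
  rw [eq_top_iff]
  rintro u -
  obtain ⟨u', hu', e⟩ := P_le_of_vShift_mem hN' u.2
  exact Subtype.ext e ▸ hu'

theorem isSimpleModule_S {n : ℕ} (I : Finset (Fin (n - 1))) : IsSimpleModule (HS n) (S I) :=
  isSimpleModule_iff_isCoatom.2 (isCoatom_sumBelow I)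

theorem subset_of_linearEquiv {n : ℕ} {I J : Finset (Fin (n - 1))} (φ : S I ≃ₗ[HS n] S J) :
    I ⊆ J := by
  obtain ⟨L, hw, hr, hL⟩ := exists_sort I
  by_contra hIJ
  -- A surviving translate would have all of `I` among its recoils, because its `I`-blocks decrease,
  -- and these recoils lie in `J`.
  have hJ : ∀ ρ, Rec ρ ⊆ J → op (sortL L) (vShift J ρ) = 0 := fun ρ hρ =>
    (op_sortL_vShift L hρ).resolve_right fun ⟨_, h⟩ => hIJ fun i hi => h <| by
      refine mem_Rec_of_antitone (I := I) (fun a b hab => ?_) hi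
      simp only [blk_sortL_eq hw ρ]
      exact hw hab
  have hP : ∀ x ∈ P J, op (sortL L) x = 0 := fun x hx => by
    have h1 : Submodule.span ℂ (Set.range fun σ : {σ : Equiv.Perm (Fin n) // Rec σ ⊆ J} =>
        vShift J σ.1) ≤ LinearMap.ker (op (sortL L)) := by
      rw [Submodule.span_le]
      rintro _ ⟨τ, rfl⟩
      exact hJ τ.1 τ.2
    exact h1 (P_le_span_vShift hx)
  have hS : ∀ z : S J, sortHS L • z = 0 := fun z => by
    obtain ⟨x, rfl⟩ := Submodule.mkQ_surjective _ z
    rw [← map_smul]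
    have : sortHS L • x = 0 := Subtype.ext (hP x.1 x.2)
    rw [this, map_zero]
  have hne : sortHS L • proj I ⟨vShift I 1, vShift_mem_P I 1⟩ ≠ 0 := by
    have hP : vPerm (sortL L 1) ∈ P I := by
      have := vPerm_mem_P (sortL L 1)
      rwa [hr] at this
    rw [← map_smul]
    have : sortHS L • (⟨vShift I 1, vShift_mem_P I 1⟩ : P I) = ⟨vPerm (sortL L 1), hP⟩ :=
      Subtype.ext (hL.trans (congrArg (fun K => vShift K (sortL L 1)) hr.symm))
    rw [this]
    exact fun h => vPerm_not_mem_sumBelow hr hP ((Submodule.Quotient.mk_eq_zero _).1 h)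
  exact hne (φ.map_eq_zero_iff.1 (by rw [map_smul, hS]))

/-! ### Simple modules as subquotients -/

/-- Some submodule of `N` has a nonzero homomorphism to `M`. -/
def HasSubquotient (R N M : Type*) [Ring R] [AddCommGroup N] [Module R N] [AddCommGroup M]
    [Module R M] : Prop := ∃ (N' : Submodule R N) (φ : N' →ₗ[R] M), φ ≠ 0

section Subquotient

variable {R N N₂ M : Type*} [Ring R] [AddCommGroup N] [Module R N] [AddCommGroup N₂] [Module R N₂]
  [AddCommGroup M] [Module R M]

/-- Either `φ` factors through the image of `N'` under `f`, or it is nonzero on the part of `N'`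
killed by `f`. -/
theorem HasSubquotient.ker_or {N' : Submodule R N} {φ : N' →ₗ[R] M} (hφ : φ ≠ 0)
    (f : N →ₗ[R] N₂) :
    (∃ N'' ≤ N' ⊓ LinearMap.ker f, ∃ ψ : N'' →ₗ[R] M, ψ ≠ 0) ∨ HasSubquotient R N₂ M := by
  let g := f.domRestrict N'
  by_cases h : LinearMap.ker g ≤ LinearMap.ker φ
  · right
    refine ⟨LinearMap.range g, (LinearMap.ker g).liftQ φ h ∘ₗ g.quotKerEquivRange.symm, fun h0 =>
      hφ (LinearMap.ext fun x => ?_)⟩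
    have := LinearMap.congr_fun h0 (g.quotKerEquivRange (Submodule.Quotient.mk x))
    simpa using this
  · left
    refine ⟨N' ⊓ LinearMap.ker f, le_rfl, φ ∘ₗ Submodule.inclusion inf_le_left, fun h0 =>
      h fun x hx => ?_⟩
    exact LinearMap.congr_fun h0 ⟨x.1, x.2, hx⟩

/-- If no `X i` works, the source of a nonzero map to `M` can be cut down to one kernel after
another, until it is zero. -/
theorem HasSubquotient.of_iInf_ker {ι : Type*} [Finite ι] {X : ι → Type*}
    [∀ i, AddCommGroup (X i)] [∀ i, Module R (X i)] (f : ∀ i, N →ₗ[R] X i)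
    (hf : ∀ x, (∀ i, f i x = 0) → x = 0) (h : HasSubquotient R N M) :
    ∃ i, HasSubquotient R (X i) M := by
  classical
  have := Fintype.ofFinite ι
  by_contra hn
  have key : ∀ s : Finset ι, ∃ N' : Submodule R N, (∀ i ∈ s, N' ≤ LinearMap.ker (f i)) ∧
      ∃ φ : N' →ₗ[R] M, φ ≠ 0 := by
    intro s
    induction s using Finset.induction_on with
    | empty =>
      obtain ⟨N', φ, hφ⟩ := h
      exact ⟨N', by simp, φ, hφ⟩
    | insert i s _ ih =>
      obtain ⟨N', hN', φ, hφ⟩ := ih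
      rcases HasSubquotient.ker_or hφ (f i) with ⟨N'', hle, ψ, hψ⟩ | h
      · refine ⟨N'', fun j hj => ?_, ψ, hψ⟩
        rcases Finset.mem_insert.1 hj with rfl | hj
        · exact hle.trans inf_le_right
        · exact (hle.trans inf_le_left).trans (hN' j hj)
      · exact absurd ⟨i, h⟩ hn
  obtain ⟨N', hN', φ, hφ⟩ := key Finset.univ
  refine hφ (LinearMap.ext fun x => ?_)
  have hx : x = 0 := Subtype.ext (hf x.1 fun i => hN' i (Finset.mem_univ i) x.2)
  rw [hx, map_zero, map_zero]

theorem HasSubquotient.of_le_range {f : N →ₗ[R] N₂} {N' : Submodule R N₂}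
    (hf : N' ≤ LinearMap.range f) {φ : N' →ₗ[R] M} (hφ : φ ≠ 0) : HasSubquotient R N M := by
  refine ⟨N'.comap f, φ ∘ₗ f.restrict (p := N'.comap f) (q := N') fun _ hx => hx, fun h0 =>
    hφ (LinearMap.ext fun y => ?_)⟩
  obtain ⟨x, hx⟩ := hf y.2
  have hxN : x ∈ N'.comap f := by rw [Submodule.mem_comap, hx]; exact y.2
  have := LinearMap.congr_fun h0 ⟨x, hxN⟩
  have e : f.restrict (p := N'.comap f) (q := N') (fun _ hx => hx) ⟨x, hxN⟩ = y := Subtype.ext hx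
  rwa [LinearMap.comp_apply, e] at this

theorem HasSubquotient.linearEquiv [IsSimpleModule R M] [IsSimpleModule R N]
    (h : HasSubquotient R N M) : Nonempty (M ≃ₗ[R] N) := by
  obtain ⟨N', φ, hφ⟩ := h
  rcases eq_bot_or_eq_top N' with rfl | rfl
  · exact absurd (LinearMap.ext fun x => by rw [Subsingleton.elim x 0, map_zero, map_zero]) hφ
  · let ψ : N →ₗ[R] M := φ ∘ₗ Submodule.topEquiv.symm.toLinearMap
    have hψ : ψ ≠ 0 := fun h0 => hφ (LinearMap.ext fun x =>
      LinearMap.congr_fun h0 (Submodule.topEquiv x))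
    exact ⟨(LinearEquiv.ofBijective ψ (LinearMap.bijective_of_ne_zero hψ)).symm⟩

end Subquotient

/-- `M` occurs in `S I`, where simplicity concludes, or in `sumBelow I`, a quotient of the product
of the smaller `P J`, where induction applies. -/
theorem exists_linearEquiv_S_of_P {n : ℕ} {M : Type*} [AddCommGroup M] [Module (HS n) M]
    [IsSimpleModule (HS n) M] (I : Finset (Fin (n - 1))) (h : HasSubquotient (HS n) (P I) M) :
    ∃ J : Finset (Fin (n - 1)), Nonempty (M ≃ₗ[HS n] S J) := by
  induction I using Finset.strongInduction with
  | H I ih =>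
    obtain ⟨N', φ, hφ⟩ := h
    rcases HasSubquotient.ker_or hφ (proj I) with ⟨N'', hle, ψ, hψ⟩ | h
    · classical
      let F : (∀ J : {J : Finset (Fin (n - 1)) // J ⊂ I}, P J.1) →ₗ[HS n] P I :=
        ∑ J, Submodule.inclusion (P_mono J.2.subset) ∘ₗ LinearMap.proj J
      have hF : (⨆ J : Finset (Fin (n - 1)), ⨆ _ : J ⊂ I, P J) ≤
          (LinearMap.range F).map (P I).subtype := by
        refine iSup₂_le fun J hJ y hy => ?_
        refine ⟨F (Pi.single ⟨J, hJ⟩ ⟨y, hy⟩), ⟨_, rfl⟩, ?_⟩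
        simp only [F, LinearMap.sum_apply, LinearMap.comp_apply, LinearMap.proj_apply]
        rw [Finset.sum_eq_single ⟨J, hJ⟩]
        · rw [Pi.single_eq_same]; rfl
        · intro K _ hK
          rw [Pi.single_eq_of_ne hK, map_zero]
        · simp
      have hle' : N'' ≤ LinearMap.range F := fun x hx => by
        have h1 : x ∈ sumBelow I := (Submodule.Quotient.mk_eq_zero _).1 (hle hx).2
        obtain ⟨y, hy, e⟩ := hF h1
        exact Subtype.ext e ▸ hy
      obtain ⟨J, hJ⟩ := HasSubquotient.of_iInf_ker
        (fun J : {J : Finset (Fin (n - 1)) // J ⊂ I} => LinearMap.proj J)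
        (fun x hx => funext hx) (HasSubquotient.of_le_range hle' hψ)
      exact ih J.1 J.2 hJ
    · have := isSimpleModule_S I
      exact ⟨I, h.linearEquiv⟩

theorem exists_linearEquiv_S {n : ℕ} {M : Type*} [AddCommGroup M] [Module (HS n) M]
    [IsSimpleModule (HS n) M] : ∃ J : Finset (Fin (n - 1)), Nonempty (M ≃ₗ[HS n] S J) := by
  have := IsSimpleModule.nontrivial (HS n) M
  obtain ⟨m, hm⟩ := exists_ne (0 : M)
  have h1 : HasSubquotient (HS n) (HS n) M := by
    refine ⟨⊤, LinearMap.toSpanSingleton (HS n) M m ∘ₗ Submodule.subtype ⊤, fun h0 => hm ?_⟩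
    simpa using LinearMap.congr_fun h0 ⟨1, Submodule.mem_top⟩
  -- An operator is determined by its values on the permutations, so evaluation embeds `HS n` in a
  -- power of `V n`.
  obtain ⟨-, N', φ, hφ⟩ := HasSubquotient.of_iInf_ker
    (fun μ : Equiv.Perm (Fin n) => LinearMap.toSpanSingleton (HS n) (V n) (e μ))
    (fun a ha => Subtype.ext (e.ext fun μ => ha μ)) h1
  have htop : ∀ x, x ∈ P (Finset.univ : Finset (Fin (n - 1))) := fun x i hi =>
    absurd (Finset.mem_univ i) hi
  exact exists_linearEquiv_S_of_P Finset.univ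
    (HasSubquotient.of_le_range (f := (P Finset.univ).subtype)
      (fun x _ => ⟨⟨x, htop x⟩, rfl⟩) hφ)

end HeckeSym

theorem theorem3p4 (n : ℕ) :
    (∀ I : Finset (Fin (n - 1)), IsSimpleModule (HeckeSym.HS n) (HeckeSym.S I)) ∧
    (∀ I J : Finset (Fin (n - 1)),
      Nonempty (HeckeSym.S I ≃ₗ[HeckeSym.HS n] HeckeSym.S J) → I = J) ∧
    (∀ (M : Type*) [AddCommGroup M] [Module (HeckeSym.HS n) M],
      IsSimpleModule (HeckeSym.HS n) M →
        ∃ I : Finset (Fin (n - 1)), Nonempty (M ≃ₗ[HeckeSym.HS n] HeckeSym.S I)) ∧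
    (∀ I : Finset (Fin (n - 1)),
      ∃ b : Module.Basis {σ : Equiv.Perm (Fin n) // HeckeSym.Rec σ = I} ℂ (HeckeSym.S I),
        ∀ σ : {σ : Equiv.Perm (Fin n) // HeckeSym.Rec σ = I}, ∃ h : HeckeSym.vPerm σ.1 ∈ HeckeSym.P I,
          b σ = HeckeSym.proj I ⟨HeckeSym.vPerm σ.1, h⟩) := by
  refine ⟨HeckeSym.isSimpleModule_S, ?_, ?_, fun I => ?_⟩
  · rintro I J ⟨φ⟩
    exact (HeckeSym.subset_of_linearEquiv φ).antisymm (HeckeSym.subset_of_linearEquiv φ.symm)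
  · intro M _ _ hM
    exact HeckeSym.exists_linearEquiv_S
  · have h : ∀ σ : {σ : Equiv.Perm (Fin n) // HeckeSym.Rec σ = I},
        HeckeSym.vPerm σ.1 ∈ HeckeSym.P I := fun σ => by
      have := HeckeSym.vPerm_mem_P σ.1
      rwa [σ.2] at this
    exact ⟨Module.Basis.mk (HeckeSym.linearIndependent_proj I h) (HeckeSym.span_proj I h),
      fun σ => ⟨h σ, Module.Basis.mk_apply _ _ σ⟩⟩
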